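/- Let $X$ be a real reflexive Banach space with dual $X^*$ and let $\varphi:X\to\mathbb R$ be locally Lipschitz continuous. For $u,v\in X$ put $$\varphi^\circ(u;v)=\limsup_{w\to u,\ t\to0^+}\frac{\varphi(w+tv)-\varphi(w)}{t},\qquad \partial\varphi(u)=\{u^*\in X^*:\ \langle u^*,v\rangle\le\varphi^\circ(u;v)\ \text{for all } v\in X\},\qquad m(u)=\min_{u^*\in\partial\varphi(u)}\|u^*\|_*.$$ For $c\in\mathbb R$ let $\overline\varphi^c=\{u\in X:\varphi(u)\le c\}$ and $K_c(\varphi)=\{u\in X: 0\in\partial\varphi(u),\ \varphi(u)=c\}$; let $\overline\varphi^\infty=X$ and $K_\infty(\varphi)=\emptyset$. Assume that $\varphi$ satisfies the Cerami condition: every sequence $(u_n)$ in $X$ such that $(\varphi(u_n))$ is bounded and $(1+\|u_n\|)\,m(u_n)\to0$ has a convergent subsequence. Let $a\in\mathbb R$ and $a<b\le\infty$ be such that $K_a(\varphi)$ is a (possibly empty) finite set and $K_c(\varphi)=\emptyset$ for all real $c\in(a,b)$. Then there exists a continuous map $h:[0,1]\times(\overline\varphi^b\setminus K_b(\varphi))\to\overline\varphi^b\setminus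 K_b(\varphi)$ such that 1. $h(0,u)=u$ and $h(1,u)\in\overline\varphi^a$ for all $u\in\overline\varphi^b\setminus K_b(\varphi)$; 2. $h(t,u)=u$ for all $(t,u)\in[0,1]\times\overline\varphi^a$; 3. $\varphi(h(t,u))\le\varphi(u)$ for all $(t,u)\in[0,1]\times(\overline\varphi^b\setminus K_b(\varphi))$. In particular, $\overline\varphi^a$ is a strong deformation retract of $\overline\varphi^b\setminus K_b(\varphi)$. -/

import Mathlib

open Filter Topology

noncomputable section

/-- A real normed space is reflexive when the canonical map into its bidual is onto. -/
def IsReflexiveSpace (X : Type*) [NormedAddCommGroup X] [NormedSpace ℝ X] : Prop :=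
  Function.Surjective (NormedSpace.inclusionInDoubleDual ℝ X)

section Clarke

variable {X : Type*} [NormedAddCommGroup X] [NormedSpace ℝ X]

/-- The generalized directional derivative `φ°(u; v)`: the upper limit of
`(φ (w + t v) - φ w) / t` as `w → u` and `t → 0⁺`. For locally Lipschitz `φ` the quotients are
bounded near the limit, so that the real `limsup` is the genuine upper limit. -/
def genDirDeriv (φ : X → ℝ) (u v : X) : ℝ :=
  limsup (fun p : X × ℝ => (φ (p.1 + p.2 • v) - φ p.1) / p.2) (𝓝 u ×ˢ 𝓝[>] (0 : ℝ))

/-- The generalized (Clarke) subdifferential `∂φ(u)`. -/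
def genSubdiff (φ : X → ℝ) (u : X) : Set (StrongDual ℝ X) :=
  {f | ∀ v : X, f v ≤ genDirDeriv φ u v}

/-- `m(u)`, the least norm of an element of `∂φ(u)`. For locally Lipschitz `φ` the set `∂φ(u)` is
nonempty and weak-* compact, so that this infimum is attained. -/
def minSubdiffNorm (φ : X → ℝ) (u : X) : ℝ :=
  sInf ((fun f : StrongDual ℝ X => ‖f‖) '' genSubdiff φ u)

/-- The critical set `K(φ)`. -/
def critSet (φ : X → ℝ) : Set X :=
  {u | (0 : StrongDual ℝ X) ∈ genSubdiff φ u}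

/-- `K_c(φ)`, the critical points at level `c`; it is empty for `c = ±∞`. -/
def critSetAt (φ : X → ℝ) (c : EReal) : Set X :=
  {u | u ∈ critSet φ ∧ (φ u : EReal) = c}

/-- The closed sublevel set `{φ ≤ c}`; it is the whole space for `c = +∞`. -/
def sublevel (φ : X → ℝ) (c : EReal) : Set X :=
  {u | (φ u : EReal) ≤ c}

/-- The Cerami condition `(C)`. -/
def CeramiCondition (φ : X → ℝ) : Prop :=
  ∀ u : ℕ → X, (∃ M : ℝ, ∀ n, |φ (u n)| ≤ M) →
    Tendsto (fun n => (1 + ‖u n‖) * minSubdiffNorm φ (u n)) atTop (𝓝 0) →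
    ∃ (x : X) (k : ℕ → ℕ), StrictMono k ∧ Tendsto (u ∘ k) atTop (𝓝 x)

end Clarke

/-- `A` is a strong deformation retract of `B`: there is a homotopy of `B` in itself, relative to
`A`, from the identity to a map with values in `A`. -/
def IsStrongDeformationRetract {X : Type*} [TopologicalSpace X] (A B : Set X) : Prop :=
  A ⊆ B ∧ ∃ h : C(unitInterval × B, B),
    (∀ u : B, h (0, u) = u) ∧
    (∀ u : B, (h (1, u) : X) ∈ A) ∧
    (∀ (t : unitInterval) (u : B), (u : X) ∈ A → h (t, u) = u)

end

open scoped NNReal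

/-! ### Calculus of the generalized directional derivative. -/

section Clarke

variable {X : Type*} [NormedAddCommGroup X] [NormedSpace ℝ X] {φ : X → ℝ}

/-! Follow a descent field for φ that vanishes on {φ ≤ a} and on the critical set, and complete its
flow at infinite time by the limits of the orbits.

If m(u) > c ≥ 0, Hahn–Banach yields v with φ°(u; v) < -c‖v‖
(`exists_genDirDeriv_lt_of_lt_minSubdiffNorm`), and upper semicontinuity of φ°(·; v) lets the same v
serve near u. Such directions form convex cones, so local choices can be glued; cones also allow
rescaling, which makes the field F bounded and globally Lipschitz (`exists_lipschitz_selection`).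
Its flow is therefore global.

On a < φ ≤ b' < b, off the critical set and away from K_a, the Cerami condition gives κ‖F(w)‖ ≤ -(1
+ ‖w‖) φ°(w; F(w)) (`CeramiCondition.exists_rate`). Adding a multiple of φ to log(1 + ‖·‖) bounds
the orbit, and adding one to a distance bounds displacements by the drop of φ. Hence an orbit
starting below b either comes arbitrarily close to K_a or converges to a point of level at most a
(`exists_approached`).

As K_a is finite, every point of level at most a is stable (`exists_forall_dist_le`): crossing a
small annulus around it costs a fixed drop of φ, which is not available just above a. Stability
turns approach into convergence (`exists_tendsto`) and makes the completed flow continuous at the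
final time. -/

lemma tendsto_add_smul_clarke (u v : X) :
    Tendsto (fun p : X × ℝ => p.1 + p.2 • v) (𝓝 u ×ˢ 𝓝[>] (0 : ℝ)) (𝓝 u) := by
  have h : Tendsto (fun p : X × ℝ => p.1 + p.2 • v) (𝓝 (u, (0 : ℝ))) (𝓝 (u + (0 : ℝ) • v)) :=
    Continuous.tendsto (by fun_prop) (u, (0 : ℝ))
  rw [zero_smul, add_zero, nhds_prod_eq] at h
  exact h.mono_left (prod_mono le_rfl nhdsWithin_le_nhds)

omit [NormedSpace ℝ X] in
lemma eventually_snd_pos_clarke (u : X) :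
    ∀ᶠ p : X × ℝ in 𝓝 u ×ˢ 𝓝[>] (0 : ℝ), 0 < p.2 :=
  tendsto_snd.eventually (eventually_mem_nhdsWithin)

lemma LocallyLipschitz.exists_eventually_abs_quotient_le (hφ : LocallyLipschitz φ) (u : X) :
    ∃ K : ℝ≥0, ∀ v : X, ∀ᶠ p : X × ℝ in 𝓝 u ×ˢ 𝓝[>] (0 : ℝ),
      |(φ (p.1 + p.2 • v) - φ p.1) / p.2| ≤ K * ‖v‖ := by
  obtain ⟨K, s, hs, hK⟩ := hφ u
  refine ⟨K, fun v => ?_⟩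
  filter_upwards [(tendsto_add_smul_clarke u v).eventually hs,
    tendsto_fst.eventually hs, eventually_snd_pos_clarke u] with p h1 h2 h3
  have := hK.dist_le_mul _ h1 _ h2
  rw [dist_eq_norm, dist_eq_norm, add_sub_cancel_left, norm_smul, Real.norm_eq_abs,
    Real.norm_eq_abs, abs_of_pos h3] at this
  rw [abs_div, abs_of_pos h3, div_le_iff₀ h3]
  linarith

lemma eventually_quotient_lt_of_genDirDeriv_lt (hφ : LocallyLipschitz φ) {u v : X} {c : ℝ}
    (h : genDirDeriv φ u v < c) :
    ∀ᶠ p : X × ℝ in 𝓝 u ×ˢ 𝓝[>] (0 : ℝ), (φ (p.1 + p.2 • v) - φ p.1) / p.2 < c := by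
  obtain ⟨K, hK⟩ := hφ.exists_eventually_abs_quotient_le u
  refine eventually_lt_of_limsup_lt h ?_
  exact isBoundedUnder_of_eventually_le ((hK v).mono fun p hp => (abs_le.1 hp).2)

lemma genDirDeriv_le_of_eventually (hφ : LocallyLipschitz φ) {u v : X} {c : ℝ}
    (h : ∀ᶠ p : X × ℝ in 𝓝 u ×ˢ 𝓝[>] (0 : ℝ), (φ (p.1 + p.2 • v) - φ p.1) / p.2 ≤ c) :
    genDirDeriv φ u v ≤ c := by
  obtain ⟨K, hK⟩ := hφ.exists_eventually_abs_quotient_le u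
  refine limsup_le_of_le ?_ h
  exact IsBoundedUnder.isCoboundedUnder_le
    (isBoundedUnder_of_eventually_ge ((hK v).mono fun p hp => (abs_le.1 hp).1))

lemma exists_genDirDeriv_le_mul_norm (hφ : LocallyLipschitz φ) (u : X) :
    ∃ K : ℝ≥0, ∀ v, genDirDeriv φ u v ≤ K * ‖v‖ := by
  obtain ⟨K, hK⟩ := hφ.exists_eventually_abs_quotient_le u
  exact ⟨K, fun v => genDirDeriv_le_of_eventually hφ ((hK v).mono fun p hp => (abs_le.1 hp).2)⟩

/-- Upper semicontinuity in the base point: the bound on the quotients holds on a neighbourhood of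
u, which is also one of every w close to u. -/
lemma eventually_genDirDeriv_lt (hφ : LocallyLipschitz φ) {u v : X} {c : ℝ}
    (h : genDirDeriv φ u v < c) : ∀ᶠ w in 𝓝 u, genDirDeriv φ w v < c := by
  obtain ⟨c', h1, h2⟩ := exists_between h
  have := eventually_quotient_lt_of_genDirDeriv_lt hφ h1
  obtain ⟨P, hP, Q, hQ, hPQ⟩ := eventually_prod_iff.1 this
  filter_upwards [eventually_eventually_nhds.2 hP] with w hw
  refine (genDirDeriv_le_of_eventually hφ ?_).trans_lt h2
  exact eventually_prod_iff.2 ⟨P, hw, Q, hQ, fun hx _ hy => (hPQ hx hy).le⟩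

lemma genDirDeriv_add_le (hφ : LocallyLipschitz φ) (u v w : X) :
    genDirDeriv φ u (v + w) ≤ genDirDeriv φ u v + genDirDeriv φ u w := by
  refine le_of_forall_pos_le_add fun ε hε => ?_
  have h1 := eventually_quotient_lt_of_genDirDeriv_lt hφ
    (lt_add_of_pos_right (genDirDeriv φ u v) (half_pos hε))
  have h2 := eventually_quotient_lt_of_genDirDeriv_lt hφ
    (lt_add_of_pos_right (genDirDeriv φ u w) (half_pos hε))
  refine genDirDeriv_le_of_eventually hφ ?_
  -- The base point of the quotient may move, so the increment along v + w splits at the shifted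
  -- base point.
  have h3 : Tendsto (fun p : X × ℝ => (p.1 + p.2 • w, p.2)) (𝓝 u ×ˢ 𝓝[>] (0 : ℝ))
      (𝓝 u ×ˢ 𝓝[>] (0 : ℝ)) := (tendsto_add_smul_clarke u w).prodMk tendsto_snd
  filter_upwards [h2, h3.eventually h1] with p hp2 hp1
  have e : p.1 + p.2 • (v + w) = p.1 + p.2 • w + p.2 • v := by rw [smul_add]; abel
  have : (φ (p.1 + p.2 • (v + w)) - φ p.1) / p.2 =
      (φ (p.1 + p.2 • w + p.2 • v) - φ (p.1 + p.2 • w)) / p.2 +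
        (φ (p.1 + p.2 • w) - φ p.1) / p.2 := by rw [e, ← add_div]; ring_nf
  rw [this]
  linarith

lemma genDirDeriv_smul_le (hφ : LocallyLipschitz φ) (u v : X) {c : ℝ} (hc : 0 < c) :
    genDirDeriv φ u (c • v) ≤ c * genDirDeriv φ u v := by
  refine le_of_forall_pos_le_add fun ε hε => ?_
  have h1 := eventually_quotient_lt_of_genDirDeriv_lt hφ
    (lt_add_of_pos_right (genDirDeriv φ u v) (div_pos hε hc))
  refine genDirDeriv_le_of_eventually hφ ?_
  have h2 : Tendsto (fun t : ℝ => t * c) (𝓝[>] 0) (𝓝[>] 0) := by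
    refine tendsto_nhdsWithin_iff.2 ⟨?_, ?_⟩
    · have : Tendsto (fun t : ℝ => t * c) (𝓝 0) (𝓝 (0 * c)) :=
        Continuous.tendsto (by fun_prop) 0
      rw [zero_mul] at this
      exact this.mono_left nhdsWithin_le_nhds
    · filter_upwards [self_mem_nhdsWithin] with t ht using mul_pos ht hc
  have h3 : Tendsto (fun p : X × ℝ => (p.1, p.2 * c)) (𝓝 u ×ˢ 𝓝[>] (0 : ℝ))
      (𝓝 u ×ˢ 𝓝[>] (0 : ℝ)) := tendsto_fst.prodMk (h2.comp tendsto_snd)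
  filter_upwards [h3.eventually h1, eventually_snd_pos_clarke u] with p hp h0
  rw [← smul_smul, div_lt_iff₀ (mul_pos h0 hc)] at hp
  rw [div_le_iff₀ h0]
  have : (genDirDeriv φ u v + ε / c) * (p.2 * c) = (c * genDirDeriv φ u v + ε) * p.2 := by
    field_simp
  linarith

lemma genDirDeriv_smul (hφ : LocallyLipschitz φ) (u v : X) {c : ℝ} (hc : 0 < c) :
    genDirDeriv φ u (c • v) = c * genDirDeriv φ u v := by
  refine (genDirDeriv_smul_le hφ u v hc).antisymm ?_
  have := genDirDeriv_smul_le hφ u (c • v) (inv_pos.2 hc)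
  rw [inv_smul_smul₀ hc.ne'] at this
  rwa [le_inv_mul_iff₀ hc] at this

lemma genDirDeriv_zero (u : X) : genDirDeriv φ u 0 = 0 := by
  simp [genDirDeriv]

/-- A form of the sandwich theorem between `-c ‖·‖` and the generalized directional derivative. -/
lemma exists_mem_genSubdiff_norm_le (hφ : LocallyLipschitz φ) {u : X} {c : ℝ} (hc : 0 ≤ c)
    (h : ∀ v, -(c * ‖v‖) ≤ genDirDeriv φ u v) : ∃ f ∈ genSubdiff φ u, ‖f‖ ≤ c := by
  -- The infimum over w is the infimal convolution of φ°(u; ·) and c‖·‖. The hypothesis makes it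
  -- finite; w = 0 and w = -v bound it by each of the two functions.
  set q : X → X → ℝ := fun v w => genDirDeriv φ u (v + w) + c * ‖w‖ with hq
  have hbd : ∀ v, BddBelow (Set.range (q v)) := by
    intro v
    refine ⟨-(c * ‖v‖), ?_⟩
    rintro _ ⟨w, rfl⟩
    have h1 := h (v + w)
    have h2 : c * ‖v + w‖ ≤ c * ‖v‖ + c * ‖w‖ := by
      rw [← mul_add]; exact mul_le_mul_of_nonneg_left (norm_add_le v w) hc
    simp only [hq]
    linarith
  have hle : ∀ v w, ⨅ w, q v w ≤ q v w := fun v w => ciInf_le (hbd v) w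
  have hhom' : ∀ r : ℝ, 0 < r → ∀ v, ⨅ w, q (r • v) w ≤ r * ⨅ w, q v w := by
    intro r hr v
    rw [Real.mul_iInf_of_nonneg hr.le]
    refine le_ciInf fun w => (hle (r • v) (r • w)).trans_eq ?_
    simp only [hq]
    rw [← smul_add, genDirDeriv_smul hφ _ _ hr, norm_smul, Real.norm_eq_abs, abs_of_pos hr]
    ring
  have hhom : ∀ r : ℝ, 0 < r → ∀ v, ⨅ w, q (r • v) w = r * ⨅ w, q v w := by
    intro r hr v
    refine (hhom' r hr v).antisymm ?_
    have := hhom' r⁻¹ (inv_pos.2 hr) (r • v)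
    rwa [inv_smul_smul₀ hr.ne', le_inv_mul_iff₀ hr] at this
  have hadd : ∀ v v', ⨅ w, q (v + v') w ≤ (⨅ w, q v w) + ⨅ w, q v' w := by
    intro v v'
    refine le_ciInf_add_ciInf fun w w' => (hle (v + v') (w + w')).trans ?_
    simp only [hq]
    have h1 := genDirDeriv_add_le hφ u (v + w) (v' + w')
    have h2 : c * ‖w + w'‖ ≤ c * ‖w‖ + c * ‖w'‖ := by
      rw [← mul_add]; exact mul_le_mul_of_nonneg_left (norm_add_le w w') hc
    rw [show v + v' + (w + w') = v + w + (v' + w') by abel]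
    linarith
  obtain ⟨g, -, hg⟩ := exists_extension_of_le_sublinear (E := X) ⊥ (fun v => ⨅ w, q v w) hhom hadd
    (by
      rintro ⟨x, hx⟩
      have hx0 : x = 0 := (Submodule.mem_bot ℝ).1 hx
      subst hx0
      -- Homogeneity forces the sublinear function to vanish at 0, which is all that an extension
      -- from the zero subspace requires.
      have h0 := hhom 2 (by norm_num) 0
      rw [smul_zero] at h0
      have e : (⟨0, hx⟩ : (⊥ : X →ₗ.[ℝ] ℝ).domain) = 0 := rfl
      rw [e, LinearPMap.map_zero]
      change 0 ≤ ⨅ w, q 0 w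
      linarith)
  have hg1 : ∀ v, g v ≤ genDirDeriv φ u v := fun v =>
    (hg v).trans ((hle v 0).trans_eq (by simp [hq]))
  have hg2 : ∀ v, g v ≤ c * ‖v‖ := fun v =>
    (hg v).trans ((hle v (-v)).trans_eq (by simp [hq, genDirDeriv_zero]))
  have hg3 : ∀ v, ‖g v‖ ≤ c * ‖v‖ := fun v => by
    rw [Real.norm_eq_abs, abs_le]
    have := hg2 (-v)
    rw [map_neg, norm_neg] at this
    exact ⟨by linarith, hg2 v⟩
  exact ⟨g.mkContinuous c hg3, fun v => hg1 v, g.mkContinuous_norm_le hc hg3⟩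

lemma genSubdiff_nonempty (hφ : LocallyLipschitz φ) (u : X) : (genSubdiff φ u).Nonempty := by
  obtain ⟨K, hK⟩ := exists_genDirDeriv_le_mul_norm hφ u
  obtain ⟨f, hf, -⟩ := exists_mem_genSubdiff_norm_le hφ (c := K) K.2 (u := u) (fun v => by
    have h1 := genDirDeriv_add_le hφ u v (-v)
    have h2 := hK (-v)
    rw [add_neg_cancel, genDirDeriv_zero] at h1
    rw [norm_neg] at h2
    linarith)
  exact ⟨f, hf⟩

lemma minSubdiffNorm_le {u : X} {f : StrongDual ℝ X} (hf : f ∈ genSubdiff φ u) :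
    minSubdiffNorm φ u ≤ ‖f‖ :=
  csInf_le ⟨0, by rintro _ ⟨g, -, rfl⟩; exact norm_nonneg g⟩ ⟨f, hf, rfl⟩

lemma minSubdiffNorm_nonneg (u : X) : 0 ≤ minSubdiffNorm φ u :=
  Real.sInf_nonneg (by rintro _ ⟨g, -, rfl⟩; exact norm_nonneg g)

lemma le_minSubdiffNorm (hφ : LocallyLipschitz φ) {u v : X} {c : ℝ}
    (h : genDirDeriv φ u v < -(c * ‖v‖)) : c ≤ minSubdiffNorm φ u := by
  refine le_csInf ((genSubdiff_nonempty hφ u).image _) ?_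
  rintro _ ⟨f, hf, rfl⟩
  have h1 : f v < -(c * ‖v‖) := (hf v).trans_lt h
  have h2 : -(‖f‖ * ‖v‖) ≤ f v := (abs_le.1 (f.le_opNorm v)).1
  by_contra! h3
  have := mul_le_mul_of_nonneg_right h3.le (norm_nonneg v)
  linarith

lemma exists_genDirDeriv_lt_of_lt_minSubdiffNorm (hφ : LocallyLipschitz φ) {u : X} {c : ℝ}
    (hc : 0 ≤ c) (h : c < minSubdiffNorm φ u) : ∃ v, genDirDeriv φ u v < -(c * ‖v‖) := by
  by_contra! h'
  obtain ⟨f, hf, hfc⟩ := exists_mem_genSubdiff_norm_le hφ hc h'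
  exact absurd (minSubdiffNorm_le hf) (by linarith)

lemma exists_genDirDeriv_neg_of_notMem_critSet {u : X} (hu : u ∉ critSet φ) :
    ∃ v, genDirDeriv φ u v < 0 := by
  by_contra! h
  exact hu fun v => by simpa using h v

lemma exists_pos_eventually_le_minSubdiffNorm (hφ : LocallyLipschitz φ) {u : X}
    (hu : u ∉ critSet φ) : ∃ c > 0, ∀ᶠ w in 𝓝 u, c ≤ minSubdiffNorm φ w := by
  obtain ⟨v, hv⟩ := exists_genDirDeriv_neg_of_notMem_critSet hu
  have hpos : 0 < ‖v‖ + 1 := by positivity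
  -- The 1 in the denominator makes the inequality below strict, and keeps the semicontinuity
  -- argument applicable.
  set c := -genDirDeriv φ u v / (‖v‖ + 1) with hc
  have hc0 : 0 < c := div_pos (by linarith) hpos
  refine ⟨c, hc0, ?_⟩
  have h1 : genDirDeriv φ u v < -(c * ‖v‖) := by
    have : c * (‖v‖ + 1) = -genDirDeriv φ u v := by rw [hc]; field_simp
    nlinarith
  exact (eventually_genDirDeriv_lt hφ h1).mono fun w hw => le_minSubdiffNorm hφ hw

lemma minSubdiffNorm_pos (hφ : LocallyLipschitz φ) {u : X} (hu : u ∉ critSet φ) :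
    0 < minSubdiffNorm φ u := by
  obtain ⟨c, hc, h⟩ := exists_pos_eventually_le_minSubdiffNorm hφ hu
  exact hc.trans_le h.self_of_nhds

lemma isClosed_critSet (hφ : LocallyLipschitz φ) : IsClosed (critSet φ) := by
  rw [← isOpen_compl_iff, isOpen_iff_mem_nhds]
  intro u hu
  obtain ⟨v, hv⟩ := exists_genDirDeriv_neg_of_notMem_critSet hu
  filter_upwards [eventually_genDirDeriv_lt hφ hv] with w hw hw'
  have := hw' v
  simp only [zero_apply] at this
  linarith

end Clarke

/-! ### Globally Lipschitz selections of cone-valued maps. -/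

section LipschitzSelection

variable {X : Type*} [NormedAddCommGroup X]

/-- The radii `r ≤ 1` for which the ball `B(u, r)` lies in `O` and `V` is bounded by `1 / r` and
`1 / r`-Lipschitz on it. -/
def lipRadii (O : Set X) (V : X → X) (u : X) : Set ℝ :=
  {r | 0 ≤ r ∧ r ≤ 1 ∧ Metric.ball u r ⊆ O ∧
    (∀ x ∈ Metric.ball u r, r * ‖V x‖ ≤ 1) ∧
    ∀ x ∈ Metric.ball u r, ∀ y ∈ Metric.ball u r, r * ‖V x - V y‖ ≤ ‖x - y‖}

/-- The supremum of `lipRadii`. -/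
noncomputable def lipRadius (O : Set X) (V : X → X) (u : X) : ℝ := sSup (lipRadii O V u)

variable {O : Set X} {V : X → X}

lemma zero_mem_lipRadii (u : X) : (0 : ℝ) ∈ lipRadii O V u := by
  simp [lipRadii]

lemma bddAbove_lipRadii (u : X) : BddAbove (lipRadii O V u) := ⟨1, fun _ hr => hr.2.1⟩

lemma lipRadius_nonneg (u : X) : 0 ≤ lipRadius O V u :=
  le_csSup (bddAbove_lipRadii u) (zero_mem_lipRadii u)

lemma lipRadius_le_one (u : X) : lipRadius O V u ≤ 1 :=
  csSup_le ⟨0, zero_mem_lipRadii u⟩ fun _ hr => hr.2.1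

lemma mem_lipRadii_of_le {u w : X} {r s : ℝ} (hr : r ∈ lipRadii O V u) (hs : 0 ≤ s)
    (h : s + dist w u ≤ r) : s ∈ lipRadii O V w := by
  obtain ⟨_, h1, h2, h3, h4⟩ := hr
  have hsr : s ≤ r := by linarith [dist_nonneg (x := w) (y := u)]
  have hb : Metric.ball w s ⊆ Metric.ball u r := Metric.ball_subset_ball' h
  exact ⟨hs, hsr.trans h1, hb.trans h2,
    fun x hx => (mul_le_mul_of_nonneg_right hsr (norm_nonneg _)).trans (h3 x (hb hx)),
    fun x hx y hy => (mul_le_mul_of_nonneg_right hsr (norm_nonneg _)).trans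
      (h4 x (hb hx) y (hb hy))⟩

lemma lipRadius_le_add_dist (u w : X) : lipRadius O V u ≤ lipRadius O V w + dist u w := by
  refine csSup_le ⟨0, zero_mem_lipRadii u⟩ fun r hr => ?_
  rcases le_total r (dist w u) with h | h
  · rw [dist_comm u w]
    linarith [lipRadius_nonneg (O := O) (V := V) w]
  · have : r - dist w u ≤ lipRadius O V w :=
      le_csSup (bddAbove_lipRadii w) (mem_lipRadii_of_le hr (by linarith) (by linarith))
    rw [dist_comm u w]
    linarith

lemma mem_lipRadii_of_lt_lipRadius {u : X} {s : ℝ} (hs : 0 ≤ s) (h : s < lipRadius O V u) :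
    s ∈ lipRadii O V u := by
  obtain ⟨r, hr, hsr⟩ := exists_lt_of_lt_csSup ⟨0, zero_mem_lipRadii u⟩ h
  exact mem_lipRadii_of_le hr hs (by simpa using hsr.le)

lemma lipRadius_eq_zero {u : X} (hu : u ∉ O) : lipRadius O V u = 0 := by
  by_contra h
  have h0 := (lipRadius_nonneg (O := O) (V := V) u).lt_of_ne' h
  obtain ⟨-, -, h2, -⟩ := mem_lipRadii_of_lt_lipRadius (half_pos h0).le (half_lt_self h0)
  exact hu (h2 (Metric.mem_ball_self (half_pos h0)))

lemma lipRadius_mul_norm_le (u : X) : lipRadius O V u * ‖V u‖ ≤ 1 := by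
  by_contra! h
  have h0 : 0 < ‖V u‖ := by
    by_contra! h'
    have : ‖V u‖ = 0 := le_antisymm h' (norm_nonneg _)
    rw [this, mul_zero] at h
    linarith
  have h1 : 1 / ‖V u‖ < lipRadius O V u := by rwa [div_lt_iff₀ h0]
  obtain ⟨s, hs1, hs2⟩ := exists_between h1
  have hs0 : 0 < s := (div_pos one_pos h0).trans hs1
  obtain ⟨-, -, -, h3, -⟩ := mem_lipRadii_of_lt_lipRadius hs0.le hs2
  have := h3 u (Metric.mem_ball_self hs0)
  rw [div_lt_iff₀ h0] at hs1
  linarith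

lemma lipRadius_mul_norm_sub_le {u w : X} (h : dist w u < lipRadius O V u) :
    lipRadius O V u * ‖V u - V w‖ ≤ ‖u - w‖ := by
  refine le_of_forall_lt_imp_le_of_dense fun y hy => ?_
  have hcont : Tendsto (fun s => s * ‖V u - V w‖) (𝓝[<] lipRadius O V u)
      (𝓝 (lipRadius O V u * ‖V u - V w‖)) :=
    (Continuous.tendsto (by fun_prop) _).mono_left nhdsWithin_le_nhds
  obtain ⟨s, hs1, hs2, hs3⟩ := ((hcont.eventually (lt_mem_nhds hy)).and
    (Ioo_mem_nhdsLT h)).exists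
  have hs0 : 0 < s := dist_nonneg.trans_lt hs2
  obtain ⟨-, -, -, -, h4⟩ := mem_lipRadii_of_lt_lipRadius hs0.le hs3
  exact hs1.le.trans (h4 u (Metric.mem_ball_self hs0) w hs2)

variable [NormedSpace ℝ X]

/-- With r the radius, V has size and local Lipschitz constant at most 1/r, and r is itself
1-Lipschitz. One factor r would leave a term of order ‖V‖ times the distance; the second factor
absorbs it. -/
lemma lipschitzWith_sq_lipRadius_smul :
    LipschitzWith 3 fun u => lipRadius O V u ^ 2 • V u := by
  refine LipschitzWith.of_dist_le_mul ?_
  have key : ∀ u w : X, lipRadius O V w ≤ lipRadius O V u →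
      dist (lipRadius O V u ^ 2 • V u) (lipRadius O V w ^ 2 • V w) ≤ 3 * dist u w := by
    intro u w hwu
    set r := lipRadius O V u with hr
    set s := lipRadius O V w with hs
    have hs0 : 0 ≤ s := lipRadius_nonneg w
    have hr0 : 0 ≤ r := lipRadius_nonneg u
    have hr1 : r ≤ 1 := lipRadius_le_one u
    have hb : r * ‖V u‖ ≤ 1 := lipRadius_mul_norm_le u
    have hrs : r ≤ s + dist u w := lipRadius_le_add_dist u w
    rw [dist_eq_norm]
    -- Within distance r the Lipschitz bound on V applies. Farther apart, the two vectors have norms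
    -- at most r and s, both bounded by the distance.
    rcases lt_or_ge (dist w u) r with h | h
    · have hl : r * ‖V u - V w‖ ≤ ‖u - w‖ := lipRadius_mul_norm_sub_le h
      rw [← dist_eq_norm u w] at hl
      have e : r ^ 2 • V u - s ^ 2 • V w = s ^ 2 • (V u - V w) + (r ^ 2 - s ^ 2) • V u := by
        module
      have n1 : ‖s ^ 2 • (V u - V w)‖ ≤ dist u w := by
        rw [norm_smul, Real.norm_eq_abs, abs_of_nonneg (sq_nonneg s)]
        have : s ^ 2 ≤ r := by nlinarith
        exact (mul_le_mul_of_nonneg_right this (norm_nonneg _)).trans hl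
      have n2 : ‖(r ^ 2 - s ^ 2) • V u‖ ≤ 2 * dist u w := by
        rw [norm_smul, Real.norm_eq_abs, abs_of_nonneg (by nlinarith)]
        have : r ^ 2 - s ^ 2 ≤ 2 * dist u w * r := by nlinarith
        calc (r ^ 2 - s ^ 2) * ‖V u‖ ≤ 2 * dist u w * r * ‖V u‖ :=
              mul_le_mul_of_nonneg_right this (norm_nonneg _)
          _ = 2 * dist u w * (r * ‖V u‖) := by ring
          _ ≤ 2 * dist u w * 1 := by gcongr
          _ = _ := by ring
      rw [e]
      linarith [norm_add_le (s ^ 2 • (V u - V w)) ((r ^ 2 - s ^ 2) • V u)]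
    · have hb' : s * ‖V w‖ ≤ 1 := lipRadius_mul_norm_le w
      have n1 : ‖r ^ 2 • V u‖ ≤ r := by
        rw [norm_smul, Real.norm_eq_abs, abs_of_nonneg (sq_nonneg r)]
        nlinarith
      have n2 : ‖s ^ 2 • V w‖ ≤ s := by
        rw [norm_smul, Real.norm_eq_abs, abs_of_nonneg (sq_nonneg s)]
        nlinarith
      rw [dist_comm w u] at h
      linarith [norm_sub_le (r ^ 2 • V u) (s ^ 2 • V w)]
  intro u w
  rcases le_total (lipRadius O V w) (lipRadius O V u) with h | h
  · exact key u w h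
  · rw [dist_comm, dist_comm u w]
    exact key w u h

lemma norm_sq_lipRadius_smul_le (u : X) : ‖lipRadius O V u ^ 2 • V u‖ ≤ 1 := by
  have h0 := lipRadius_nonneg (O := O) (V := V) u
  have h1 := lipRadius_le_one (O := O) (V := V) u
  have h2 := lipRadius_mul_norm_le (O := O) (V := V) u
  rw [norm_smul, Real.norm_eq_abs, abs_of_nonneg (sq_nonneg _)]
  nlinarith

omit [NormedSpace ℝ X] in
lemma lipRadius_pos {u : X} (hO : IsOpen O) (hu : u ∈ O)
    (hV : ∃ K : ℝ≥0, ∃ t ∈ 𝓝 u, LipschitzOnWith K V t) : 0 < lipRadius O V u := by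
  obtain ⟨K, t, ht, hK⟩ := hV
  obtain ⟨ε, hε, hb⟩ := Metric.mem_nhds_iff.1 (inter_mem ht (hO.mem_nhds hu))
  have hK0 : (0 : ℝ) ≤ K := K.2
  have hD : 0 < 1 + K + ‖V u‖ := by positivity
  set r := min (min ε 1) (1 / (1 + K + ‖V u‖)) with hr
  have hr0 : 0 < r := by positivity
  have hrε : r ≤ ε := (min_le_left _ _).trans (min_le_left _ _)
  have hr1 : r ≤ 1 := (min_le_left _ _).trans (min_le_right _ _)
  have hrD : r * (1 + K + ‖V u‖) ≤ 1 := by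
    rw [← le_div_iff₀ hD]; exact min_le_right _ _
  have hsub : Metric.ball u r ⊆ t ∩ O := (Metric.ball_subset_ball hrε).trans hb
  refine hr0.trans_le (le_csSup (bddAbove_lipRadii u) ⟨hr0.le, hr1, fun x hx => (hsub hx).2, ?_, ?_⟩)
  · intro x hx
    have h1 := hK.dist_le_mul x (hsub hx).1 u (mem_of_mem_nhds ht)
    have h2 : dist x u < r := hx
    have h3 : ‖V x‖ ≤ ‖V u‖ + dist (V x) (V u) := by
      rw [dist_eq_norm]; linarith [norm_sub_norm_le (V x) (V u)]
    have h4 : K * dist x u ≤ K * 1 := by gcongr; linarith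
    have h5 : ‖V x‖ ≤ 1 + K + ‖V u‖ := by linarith
    exact (mul_le_mul_of_nonneg_left h5 hr0.le).trans hrD
  · intro x hx y hy
    have h1 := hK.dist_le_mul x (hsub hx).1 y (hsub hy).1
    rw [dist_eq_norm, dist_eq_norm] at h1
    have h2 : r * K ≤ 1 := by nlinarith [norm_nonneg (V u), mul_nonneg hr0.le (norm_nonneg (V u))]
    calc r * ‖V x - V y‖ ≤ r * (K * ‖x - y‖) := by gcongr
      _ = r * K * ‖x - y‖ := by ring
      _ ≤ 1 * ‖x - y‖ := by gcongr
      _ = _ := one_mul _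

omit [NormedSpace ℝ X] in
lemma exists_lipschitz_pos_iff_mem {W : Set X} (hW : IsOpen W) :
    ∃ g : X → ℝ, LipschitzWith 1 g ∧ (∀ u, 0 ≤ g u) ∧ ∀ u, 0 < g u ↔ u ∈ W := by
  -- The distance to the empty set is 0 by convention, so W = X needs its own function.
  rcases Set.eq_empty_or_nonempty Wᶜ with h | h
  · refine ⟨fun _ => 1, (LipschitzWith.const 1).weaken zero_le_one, fun _ => zero_le_one,
      fun u => ?_⟩
    have : u ∈ W := by
      by_contra hu
      exact (h ▸ hu : u ∈ (∅ : Set X))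
    simp [this]
  · refine ⟨fun u => Metric.infDist u Wᶜ, Metric.lipschitz_infDist_pt _,
      fun u => Metric.infDist_nonneg, fun u => ?_⟩
    rw [← hW.isClosed_compl.notMem_iff_infDist_pos h, Set.notMem_compl_iff]

/-- A locally Lipschitz selection of a cone-valued map that admits locally constant selections. -/
lemma exists_locallyLipschitz_selection (hO : IsOpen O) (P : X → ConvexCone ℝ X)
    (hP : ∀ x ∈ O, ∃ v : X, ∀ᶠ w in 𝓝 x, v ∈ P w) :
    ∃ V : X → X, (∀ u ∈ O, V u ∈ P u) ∧
      ∀ u ∈ O, ∃ K : ℝ≥0, ∃ t ∈ 𝓝 u, LipschitzOnWith K V t := by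
  choose! v hv using hP
  have hU : ∀ x : O, ∃ U : Set X, U ⊆ {w | v x ∈ P w} ∧ IsOpen U ∧ (x : X) ∈ U := fun x =>
    mem_nhds_iff.1 (hv x x.2)
  choose U hUP hUo hxU using hU
  obtain ⟨A, hAo, hAc, hAf, hAU⟩ := precise_refinement (fun x : O => (Subtype.val ⁻¹' U x : Set O))
    (fun x => (hUo x).preimage continuous_subtype_val)
    (Set.iUnion_eq_univ_iff.2 fun x => ⟨x, hxU x⟩)
  -- These weights need not sum to 1: membership in a cone survives positive scaling.
  choose g hgL hg0 hgpos using fun x : O =>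
    exists_lipschitz_pos_iff_mem (hO.isOpenMap_subtype_val _ (hAo x))
  have hloc : ∀ u ∈ O, ∃ t ∈ 𝓝 u, ∃ s : Finset O,
      (∀ i, ∀ w ∈ t, 0 < g i w → i ∈ s) ∧ ∀ w ∈ t,
      ∑ᶠ i, g i w • v i = ∑ i ∈ s, g i w • v i := by
    intro u hu
    obtain ⟨t, ht, hfin⟩ := hAf ⟨u, hu⟩
    refine ⟨Subtype.val '' t, hO.isOpenEmbedding_subtypeVal.image_mem_nhds.2 ht, hfin.toFinset,
      ?_⟩
    have hmem : ∀ i, ∀ w ∈ Subtype.val '' t, 0 < g i w → i ∈ hfin.toFinset := by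
      rintro i _ ⟨w, hw, rfl⟩ hi
      obtain ⟨w', hw', e⟩ := (hgpos i w).1 hi
      rw [Subtype.val_injective e] at hw'
      exact (Set.Finite.mem_toFinset _).2 ⟨w, hw', hw⟩
    refine ⟨hmem, fun w hw => finsum_eq_sum_of_support_subset _ fun i hi => ?_⟩
    exact hmem i w hw ((hg0 i w).lt_of_ne' fun h => hi (by simp [h]))
  refine ⟨fun w => ∑ᶠ i, g i w • v i, fun u hu => ?_, fun u hu => ?_⟩
  · obtain ⟨t, ht, s, hts, hs⟩ := hloc u hu
    obtain ⟨i₀, hi₀⟩ := Set.iUnion_eq_univ_iff.1 hAc ⟨u, hu⟩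
    have hi₀' : 0 < g i₀ u := (hgpos i₀ u).2 ⟨⟨u, hu⟩, hi₀, rfl⟩
    have hmem : ∀ i, 0 < g i u → g i u • v i ∈ P u := by
      intro i hi
      obtain ⟨w, hw, e⟩ := (hgpos i u).1 hi
      refine (P u).smul_mem hi ?_
      have := hAU i hw
      rw [Set.mem_preimage, e] at this
      exact hUP i this
    -- Zero terms are discarded because the cone need not contain 0; the remaining sum is nonempty.
    have hss : ∑ i ∈ s with 0 < g i u, g i u • v i = ∑ i ∈ s, g i u • v i :=
      Finset.sum_filter_of_ne fun i _ h =>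
        (hg0 i u).lt_of_ne' fun h' => h (by simp [h'])
    dsimp only
    rw [hs u (mem_of_mem_nhds ht), ← hss]
    refine Finset.sum_induction_nonempty (fun i => g i u • v i) (fun y => y ∈ P u)
      (fun a b ha hb => (P u).add_mem ha hb) ?_ fun i hi => hmem i (Finset.mem_filter.1 hi).2
    exact ⟨i₀, Finset.mem_filter.2 ⟨hts i₀ u (mem_of_mem_nhds ht) hi₀', hi₀'⟩⟩
  · obtain ⟨t, ht, s, hts, hs⟩ := hloc u hu
    refine ⟨∑ i ∈ s, ‖v i‖₊, t, ht, LipschitzOnWith.of_dist_le_mul fun x hx y hy => ?_⟩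
    rw [hs x hx, hs y hy, dist_eq_norm, ← Finset.sum_sub_distrib]
    push_cast
    rw [Finset.sum_mul]
    refine norm_sum_le_of_le _ fun i _ => ?_
    rw [← sub_smul, norm_smul, mul_comm, ← dist_eq_norm]
    gcongr
    simpa using (hgL i).dist_le_mul x y

lemma exists_lipschitz_selection (hO : IsOpen O) (P : X → ConvexCone ℝ X)
    (hP : ∀ x ∈ O, ∃ v : X, ∀ᶠ w in 𝓝 x, v ∈ P w) :
    ∃ F : X → X, LipschitzWith 3 F ∧ (∀ u, ‖F u‖ ≤ 1) ∧ (∀ u ∉ O, F u = 0) ∧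
      ∀ u ∈ O, F u ∈ P u := by
  obtain ⟨V, h1, h2⟩ := exists_locallyLipschitz_selection hO P hP
  refine ⟨fun u => lipRadius O V u ^ 2 • V u, lipschitzWith_sq_lipRadius_smul,
    norm_sq_lipRadius_smul_le, fun u hu => by simp [lipRadius_eq_zero hu], fun u hu => ?_⟩
  exact (P u).smul_mem (pow_pos (lipRadius_pos hO hu (h2 u hu)) 2) (h1 u hu)

end LipschitzSelection

/-! ### Global flows and Lyapunov functionals. -/

section Flow

variable {X : Type*} [NormedAddCommGroup X] [NormedSpace ℝ X]

lemma LipschitzWith.exists_solution_Icc [CompleteSpace X] {F : X → X} {K : ℝ≥0}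
    (hF : LipschitzWith K F) (hb : ∀ u, ‖F u‖ ≤ 1) (u : X) (T : ℝ≥0) :
    ∃ α : ℝ → X, α 0 = u ∧
      ∀ t ∈ Set.Icc (-T : ℝ) T, HasDerivWithinAt α (F (α t)) (Set.Icc (-T : ℝ) T) t := by
  have h0 : (0 : ℝ) ∈ Set.Icc (-T : ℝ) T := by simp
  have : IsPicardLindelof (fun _ => F) (⟨0, h0⟩ : Set.Icc (-T : ℝ) T) u T 0 1 K :=
    IsPicardLindelof.of_time_independent (fun x _ => by simpa using hb x) hF.lipschitzOnWith
      (by simp)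
  exact this.exists_eq_forall_mem_Icc_hasDerivWithinAt₀

lemma LipschitzWith.exists_global_solution [CompleteSpace X] {F : X → X} {K : ℝ≥0}
    (hF : LipschitzWith K F) (hb : ∀ u, ‖F u‖ ≤ 1) (u : X) :
    ∃ α : ℝ → X, α 0 = u ∧ ∀ t, HasDerivAt α (F (α t)) t := by
  choose α hα0 hα using fun n : ℕ => hF.exists_solution_Icc hb u n
  have hd : ∀ n : ℕ, ∀ t ∈ Set.Ioo (-n : ℝ) n, HasDerivAt (α n) (F (α n t)) t := fun n t ht =>
    (hα n t (Set.Ioo_subset_Icc_self ht)).hasDerivAt (Icc_mem_nhds ht.1 ht.2)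
  have heq : ∀ m n : ℕ, 0 < m → m ≤ n → Set.EqOn (α m) (α n) (Set.Ioo (-m : ℝ) m) := by
    intro m n hm hmn
    have hm' : (0 : ℝ) < m := by exact_mod_cast hm
    have hmn' : (m : ℝ) ≤ n := by exact_mod_cast hmn
    refine ODE_solution_unique_of_mem_Ioo (v := fun _ => F) (s := fun _ => Set.univ) (K := K)
      (t₀ := 0) (fun _ _ => hF.lipschitzOnWith) ⟨by linarith, hm'⟩
      (fun t ht => ⟨hd m t ht, trivial⟩)
      (fun t ht => ⟨hd n t ⟨by linarith [ht.1], by linarith [ht.2]⟩, trivial⟩)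
      ((hα0 m).trans (hα0 n).symm)
  -- The extra 1 puts t in the open interval of its solution; one more, in N below, gives a single
  -- solution for all times near t.
  refine ⟨fun t => α (⌈|t|⌉₊ + 1) t, hα0 _, fun t => ?_⟩
  set N := ⌈|t|⌉₊ + 2 with hN
  have habs : ∀ s : ℝ, |s| < (⌈|s|⌉₊ + 1 : ℕ) := fun s => by
    push_cast
    linarith [Nat.le_ceil |s|]
  have hnear : ∀ᶠ s in 𝓝 t, α (⌈|s|⌉₊ + 1) s = α N s := by
    have h1 : ∀ᶠ s in 𝓝 t, |s| < (⌈|t|⌉₊ : ℝ) + 1 :=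
      (continuous_abs.tendsto t).eventually (gt_mem_nhds (by linarith [Nat.le_ceil |t|]))
    filter_upwards [h1] with s hs
    refine heq _ _ (Nat.succ_pos _) ?_ (abs_lt.1 (habs s))
    have : ⌈|s|⌉₊ ≤ ⌈|t|⌉₊ + 1 := Nat.ceil_le.2 (by push_cast; exact hs.le)
    omega
  have ht : t ∈ Set.Ioo (-N : ℝ) N := by
    refine abs_lt.1 ((habs t).trans ?_)
    exact_mod_cast Nat.lt_succ_self _
  have := (hd N t ht).congr_of_eventuallyEq hnear
  rwa [← hnear.self_of_nhds] at this

/-- The flow of a bounded Lipschitz vector field. -/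
structure IsFlowOf (F : X → X) (σ : ℝ → X → X) : Prop where
  zero : ∀ u, σ 0 u = u
  hasDerivAt : ∀ u t, HasDerivAt (fun s => σ s u) (F (σ t u)) t
  add : ∀ s t u, σ (s + t) u = σ s (σ t u)
  continuous : Continuous fun p : ℝ × X => σ p.1 p.2
  fixed : ∀ u, F u = 0 → ∀ t, σ t u = u

/-- Uniqueness gives the group law and the rest points. Joint continuity combines unit speed in time
with Grönwall in space, where negative times use the reversed field. -/
lemma LipschitzWith.exists_isFlowOf [CompleteSpace X] {F : X → X} {K : ℝ≥0}
    (hF : LipschitzWith K F) (hb : ∀ u, ‖F u‖ ≤ 1) : ∃ σ : ℝ → X → X, IsFlowOf F σ := by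
  choose σ h0 hd using hF.exists_global_solution hb
  have huniq : ∀ f g : ℝ → X, (∀ t, HasDerivAt f (F (f t)) t) → (∀ t, HasDerivAt g (F (g t)) t) →
      f 0 = g 0 → f = g := fun f g hf hg h =>
    ODE_solution_unique_univ (v := fun _ => F) (s := fun _ => Set.univ) (K := K)
      (t₀ := 0) (fun _ => hF.lipschitzOnWith) (fun t => ⟨hf t, trivial⟩)
      (fun t => ⟨hg t, trivial⟩) h
  have hlip : ∀ u s t, dist (σ u s) (σ u t) ≤ 1 * dist s t := by
    intro u s t
    rw [dist_eq_norm, dist_eq_norm]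
    exact Convex.norm_image_sub_le_of_norm_hasDerivWithin_le
      (fun x _ => (hd u x).hasDerivWithinAt) (fun x _ => hb _) convex_univ trivial trivial
  have hpos : ∀ u w t, 0 ≤ t → dist (σ u t) (σ w t) ≤ dist u w * Real.exp (K * t) := by
    intro u w t ht
    have := dist_le_of_trajectories_ODE (v := fun _ => F) (K := K) (a := 0) (b := t)
      (f := σ u) (g := σ w) (δ := dist u w) (fun _ => hF)
      (fun x _ => (hd u x).continuousAt.continuousWithinAt)
      (fun x _ => (hd u x).hasDerivWithinAt)
      (fun x _ => (hd w x).continuousAt.continuousWithinAt)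
      (fun x _ => (hd w x).hasDerivWithinAt) (by rw [h0, h0]) t ⟨ht, le_rfl⟩
    simpa using this
  have hneg : ∀ u w t, t ≤ 0 → dist (σ u t) (σ w t) ≤ dist u w * Real.exp (K * (-t)) := by
    intro u w t ht
    have hdn : ∀ u x, HasDerivAt (fun s => σ u (-s)) (-F (σ u (-x))) x := by
      intro u x
      have := (hd u (-x)).scomp x (hasDerivAt_neg x)
      simpa [Function.comp_def] using this
    have := dist_le_of_trajectories_ODE (v := fun _ x => -F x) (K := K) (a := 0) (b := -t)
      (f := fun s => σ u (-s)) (g := fun s => σ w (-s)) (δ := dist u w) (fun _ => hF.neg)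
      (fun x _ => (hdn u x).continuousAt.continuousWithinAt)
      (fun x _ => (hdn u x).hasDerivWithinAt)
      (fun x _ => (hdn w x).continuousAt.continuousWithinAt)
      (fun x _ => (hdn w x).hasDerivWithinAt) (by simp [h0]) (-t) ⟨by linarith, le_rfl⟩
    simpa using this
  have hspace : ∀ u w t, dist (σ u t) (σ w t) ≤ dist u w * Real.exp (K * |t|) := by
    intro u w t
    rcases le_total 0 t with h | h
    · rw [abs_of_nonneg h]; exact hpos u w t h
    · rw [abs_of_nonpos h]; exact hneg u w t h
  refine ⟨fun t u => σ u t, h0, hd, fun s t u => ?_, ?_, fun u hu t => ?_⟩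
  · refine congrFun (huniq (fun s => σ u (s + t)) (σ (σ u t)) (fun s => ?_) (hd _) ?_) s
    · simpa using (hd u (s + t)).comp_add_const s t
    · simp [h0]
  · rw [continuous_iff_continuousAt]
    rintro ⟨t, u⟩
    rw [ContinuousAt, tendsto_iff_dist_tendsto_zero]
    have hlim : Tendsto (fun p : ℝ × X => 1 * dist p.1 t + dist p.2 u * Real.exp (K * |t|))
        (𝓝 (t, u)) (𝓝 0) := by
      have : Continuous fun p : ℝ × X => 1 * dist p.1 t + dist p.2 u * Real.exp (K * |t|) := by
        fun_prop
      simpa using this.tendsto (t, u)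
    refine squeeze_zero (fun _ => dist_nonneg) (fun p => ?_) hlim
    refine (dist_triangle _ (σ p.2 t) _).trans (add_le_add ?_ ?_)
    · exact hlip p.2 p.1 t
    · exact hspace p.2 u t
  · refine congrFun (huniq (σ u) (fun _ => u) (hd u) (fun s => ?_) (h0 u)) t
    rw [hu]
    exact hasDerivAt_const s u

lemma antitoneOn_of_right_upper_estimate {G : ℝ → ℝ} (hG : Continuous G)
    (h : ∀ s ≥ 0, ∀ ε > 0, ∀ᶠ t in 𝓝[>] s, G t - G s ≤ ε * (t - s)) :
    AntitoneOn G (Set.Ici 0) := by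
  intro x hx y _ hxy
  refine image_le_of_liminf_slope_right_le_deriv_boundary (a := x) (b := y) (f := G)
    (B := fun _ => G x) (B' := fun _ => 0) hG.continuousOn le_rfl continuousOn_const
    (fun z _ => hasDerivWithinAt_const _ _ _) (fun z hz r hr => ?_) ⟨hxy, le_rfl⟩
  refine Eventually.frequently ?_
  have hx0 : 0 ≤ x := hx
  filter_upwards [h z (hx0.trans hz.1) (r / 2) (half_pos hr), self_mem_nhdsWithin] with t ht hzt
  have hzt' : 0 < t - z := sub_pos.2 hzt
  rw [slope_def_field, div_lt_iff₀ hzt']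
  nlinarith

/-- The curve differs from its tangent line by o(t - s), and the local Lipschitz constant turns this
into a negligible error in φ. -/
lemma eventually_sub_le_of_hasDerivAt {φ : X → ℝ} (hφ : LocallyLipschitz φ) {γ : ℝ → X} {y : X}
    {s c : ℝ} (hγ : HasDerivAt γ y s) (hc : genDirDeriv φ (γ s) y < c) :
    ∀ᶠ t in 𝓝[>] s, φ (γ t) - φ (γ s) ≤ c * (t - s) := by
  obtain ⟨K, U, hU, hK⟩ := hφ (γ s)
  set δ := (c - genDirDeriv φ (γ s) y) / 2 with hδ
  have hδ0 : 0 < δ := by rw [hδ]; linarith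
  have h1 : genDirDeriv φ (γ s) y < c - δ := by rw [hδ]; linarith
  have hq := eventually_quotient_lt_of_genDirDeriv_lt hφ h1
  have ht1 : Tendsto (fun t => (γ s, t - s)) (𝓝[>] s) (𝓝 (γ s) ×ˢ 𝓝[>] (0 : ℝ)) := by
    refine tendsto_const_nhds.prodMk (tendsto_nhdsWithin_iff.2 ⟨?_, ?_⟩)
    · have : Tendsto (fun t => t - s) (𝓝 s) (𝓝 (s - s)) := Continuous.tendsto (by fun_prop) s
      rw [sub_self] at this
      exact this.mono_left nhdsWithin_le_nhds
    · filter_upwards [self_mem_nhdsWithin] with t ht using sub_pos.2 (Set.mem_Ioi.1 ht)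
  have ho := (hasDerivAt_iff_isLittleO.1 hγ).def (c := δ / (K + 1))
    (div_pos hδ0 (by positivity))
  filter_upwards [ht1.eventually hq, nhdsWithin_le_nhds ho,
    nhdsWithin_le_nhds (hγ.continuousAt.eventually hU),
    ht1.eventually ((tendsto_add_smul_clarke (γ s) y).eventually hU), self_mem_nhdsWithin]
    with t hq ho hU1 hU2 hst
  have hst' : 0 < t - s := sub_pos.2 hst
  rw [div_lt_iff₀ hst'] at hq
  have hl := hK.dist_le_mul _ hU1 _ hU2
  rw [Real.norm_eq_abs, abs_of_pos hst'] at ho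
  rw [dist_eq_norm, dist_eq_norm, Real.norm_eq_abs, ← sub_sub] at hl
  have h2 : (K : ℝ) * (δ / (K + 1) * (t - s)) ≤ δ * (t - s) := by
    have : (K : ℝ) * (δ / (K + 1)) ≤ δ := by
      have hK0 : (0 : ℝ) ≤ K := K.2
      rw [mul_div_assoc', div_le_iff₀ (by positivity)]
      nlinarith
    nlinarith
  have h3 := (le_abs_self _).trans (hl.trans ((mul_le_mul_of_nonneg_left ho K.2).trans h2))
  linarith

/-- A Lyapunov functional `ψ + C φ` along a curve driven by `F`. -/
lemma antitoneOn_add_mul_comp {φ : X → ℝ} (hφ : LocallyLipschitz φ) {F : X → X} {γ : ℝ → X}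
    (hγ : ∀ t, HasDerivAt γ (F (γ t)) t) {ψ : X → ℝ} (hψ : Continuous ψ) {C : ℝ} (hC : 0 ≤ C)
    (h : ∀ t ≥ 0, ∃ L ≥ 0, (∀ᶠ w in 𝓝 (γ t), ψ w - ψ (γ t) ≤ L * ‖w - γ t‖) ∧
      L * ‖F (γ t)‖ ≤ -(C * genDirDeriv φ (γ t) (F (γ t)))) :
    AntitoneOn (fun t => ψ (γ t) + C * φ (γ t)) (Set.Ici 0) := by
  have hγc : Continuous γ := continuous_iff_continuousAt.2 fun t => (hγ t).continuousAt
  refine antitoneOn_of_right_upper_estimate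
    ((hψ.comp hγc).add (continuous_const.mul (hφ.continuous.comp hγc))) fun s hs ε hε => ?_
  obtain ⟨L, hL0, hL, hLC⟩ := h s hs
  -- Both tolerances are chosen so that, after multiplication by C or L, each costs at most ε/2;
  -- adding 1 in the denominators covers C = 0 and L = 0.
  have h1 := eventually_sub_le_of_hasDerivAt hφ (hγ s)
    (lt_add_of_pos_right (genDirDeriv φ (γ s) (F (γ s))) (div_pos hε (by positivity : 0 < 2 * (C + 1))))
  have ho := (hasDerivAt_iff_isLittleO.1 (hγ s)).def (c := ε / (2 * (L + 1)))
    (div_pos hε (by positivity))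
  filter_upwards [h1, nhdsWithin_le_nhds ho, nhdsWithin_le_nhds ((hγ s).continuousAt.eventually hL),
    self_mem_nhdsWithin] with t h1 ho hL hst
  have hst' : 0 < t - s := sub_pos.2 hst
  rw [Real.norm_eq_abs, abs_of_pos hst'] at ho
  have hn : ‖γ t - γ s‖ ≤ ε / (2 * (L + 1)) * (t - s) + (t - s) * ‖F (γ s)‖ := by
    have e : γ t - γ s = (γ t - γ s - (t - s) • F (γ s)) + (t - s) • F (γ s) := by abel
    rw [e]
    refine (norm_add_le _ _).trans (add_le_add ho ?_)
    rw [norm_smul, Real.norm_eq_abs, abs_of_pos hst']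
  have hLε : L * (ε / (2 * (L + 1))) ≤ ε / 2 := by
    rw [mul_div_assoc', div_le_div_iff₀ (by positivity) (by positivity)]
    nlinarith
  have hCε : C * (ε / (2 * (C + 1))) ≤ ε / 2 := by
    rw [mul_div_assoc', div_le_div_iff₀ (by positivity) (by positivity)]
    nlinarith
  have h2 := hL.trans (mul_le_mul_of_nonneg_left hn hL0)
  have h3 := mul_le_mul_of_nonneg_left h1 hC
  have h4 := mul_le_mul_of_nonneg_right hLε hst'.le
  have h5 := mul_le_mul_of_nonneg_right hCε hst'.le
  have h6 := mul_le_mul_of_nonneg_right hLC hst'.le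
  nlinarith

end Flow

/-! ### The descent flow, the Cerami rate and stability. -/

section DescentFlow

variable {X : Type*} [NormedAddCommGroup X] [NormedSpace ℝ X] {φ : X → ℝ}

/-- The points above the level `a` that are not critical. -/
def regularAbove (φ : X → ℝ) (a : ℝ) : Set X := {u | a < φ u} \ critSet φ

lemma isOpen_regularAbove (hφ : LocallyLipschitz φ) (a : ℝ) : IsOpen (regularAbove φ a) :=
  (isOpen_lt continuous_const hφ.continuous).sdiff (isClosed_critSet hφ)

/-- The directions `v` that descend at `w` at a rate at least `‖v‖ m(x) / 2` for all those `x` that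
are close to `w` relative to `m(x)`. -/
def descentCone (hφ : LocallyLipschitz φ) (O : Set X) (w : X) : ConvexCone ℝ X where
  carrier := {v | genDirDeriv φ w v < 0 ∧ ∀ c ≥ 0,
    (∀ x ∈ O, dist x w < minSubdiffNorm φ x / 2 → |φ x - φ w| < minSubdiffNorm φ x / 2 →
      c ≤ minSubdiffNorm φ x / 2) → genDirDeriv φ w v ≤ -(c * ‖v‖)}
  smul_mem' := by
    rintro r hr v ⟨h1, h2⟩
    refine ⟨?_, fun c hc h => ?_⟩
    · rw [genDirDeriv_smul hφ w v hr]
      exact mul_neg_of_pos_of_neg hr h1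
    · rw [genDirDeriv_smul hφ w v hr, norm_smul, Real.norm_eq_abs, abs_of_pos hr]
      have := mul_le_mul_of_nonneg_left (h2 c hc h) hr.le
      linarith
  add_mem' := by
    rintro v ⟨h1, h2⟩ v' ⟨h1', h2'⟩
    refine ⟨(genDirDeriv_add_le hφ w v v').trans_lt (by linarith), fun c hc h => ?_⟩
    have h3 := h2 c hc h
    have h4 := h2' c hc h
    have h5 := mul_le_mul_of_nonneg_left (norm_add_le v v') hc
    linarith [genDirDeriv_add_le hφ w v v']

/-- For w near x, the value m(x)/2 is among those that c must not exceed, so a direction steep at x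
suffices at w. A demand in terms of m(w) alone could fail, since m is only lower semicontinuous. -/
lemma exists_eventually_mem_descentCone (hφ : LocallyLipschitz φ) {O : Set X} {x : X} (hx : x ∈ O)
    (hcrit : x ∉ critSet φ) : ∃ v, ∀ᶠ w in 𝓝 x, v ∈ descentCone hφ O w := by
  have hm := minSubdiffNorm_pos hφ hcrit
  set μ := minSubdiffNorm φ x / 2 with hμ
  have hμ0 : 0 < μ := half_pos hm
  obtain ⟨v, hv⟩ := exists_genDirDeriv_lt_of_lt_minSubdiffNorm hφ hμ0.le (half_lt_self hm)
  refine ⟨v, ?_⟩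
  have h1 : ∀ᶠ w in 𝓝 x, dist x w < μ := by
    filter_upwards [Metric.ball_mem_nhds x hμ0] with w hw
    rwa [dist_comm]
  have h2 : ∀ᶠ w in 𝓝 x, |φ x - φ w| < μ := by
    have : Tendsto (fun w => |φ x - φ w|) (𝓝 x) (𝓝 |φ x - φ x|) :=
      ((continuous_const.sub hφ.continuous).abs).tendsto x
    rw [sub_self, abs_zero] at this
    exact this.eventually (gt_mem_nhds hμ0)
  filter_upwards [eventually_genDirDeriv_lt hφ hv, h1, h2] with w hw h1 h2
  refine ⟨hw.trans_le (neg_nonpos.2 (by positivity)), fun c hc h => hw.le.trans ?_⟩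
  exact neg_le_neg (mul_le_mul_of_nonneg_right (h x hx h1 h2) (norm_nonneg v))

/-- A flow that decreases `φ` on `{φ > a}` off the critical points and rests elsewhere, at a rate
controlled below the level `b` away from the critical points of level `a`. -/
structure IsDescentFlow (φ : X → ℝ) (a : ℝ) (b : EReal) (F : X → X) (σ : ℝ → X → X) : Prop where
  isFlow : IsFlowOf F σ
  eq_zero : ∀ u ∉ regularAbove φ a, F u = 0
  neg : ∀ u ∈ regularAbove φ a, genDirDeriv φ u (F u) < 0
  rate : ∀ b' : ℝ, (b' : EReal) < b → ∀ δ > 0, ∃ κ > 0, ∀ w ∈ regularAbove φ a, φ w ≤ b' →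
    (∀ z ∈ critSetAt φ (a : EReal), δ ≤ dist w z) →
    κ * ‖F w‖ ≤ -((1 + ‖w‖) * genDirDeriv φ w (F w))

lemma mem_critSetAt_coe {u : X} {c : ℝ} :
    u ∈ critSetAt φ (c : EReal) ↔ u ∈ critSet φ ∧ φ u = c := by
  simp [critSetAt]

/-- If the rate fails along w_n, the cone condition supplies nearby x_n forming a Cerami sequence. A
limit point is critical with level in [a, b'], hence lies in K_a, although the w_n stay δ away from
it. -/
lemma CeramiCondition.exists_rate (hφ : LocallyLipschitz φ) (hC : CeramiCondition φ) {a b' : ℝ}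
    (hK : ∀ u, a < φ u → φ u ≤ b' → u ∉ critSet φ) {F : X → X}
    (hF : ∀ u ∈ regularAbove φ a, F u ∈ descentCone hφ (regularAbove φ a) u)
    {δ : ℝ} (hδ : 0 < δ) : ∃ κ > 0, ∀ w ∈ regularAbove φ a, φ w ≤ b' →
      (∀ z ∈ critSetAt φ (a : EReal), δ ≤ dist w z) →
      κ * ‖F w‖ ≤ -((1 + ‖w‖) * genDirDeriv φ w (F w)) := by
  by_contra! hcon
  have hκ : ∀ n : ℕ, (0 : ℝ) < 1 / (n + 1) := fun n => Nat.one_div_pos_of_nat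
  have hκ1 : ∀ n : ℕ, (1 : ℝ) / (n + 1) ≤ 1 := fun n => by
    rw [div_le_one (by positivity)]
    linarith [(Nat.cast_nonneg n : (0 : ℝ) ≤ n)]
  have hκlim : Tendsto (fun n : ℕ => (1 : ℝ) / (n + 1)) atTop (𝓝 0) :=
    tendsto_one_div_add_atTop_nhds_zero_nat
  choose w hwO hwb hwδ hw using fun n : ℕ => hcon (1 / (n + 1)) (hκ n)
  have hex : ∀ n, ∃ x ∈ regularAbove φ a, dist x (w n) < minSubdiffNorm φ x / 2 ∧
      |φ x - φ (w n)| < minSubdiffNorm φ x / 2 ∧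
      minSubdiffNorm φ x / 2 < 1 / (n + 1) / (1 + ‖w n‖) := by
    intro n
    by_contra! h
    have h0 : 0 < 1 + ‖w n‖ := by positivity
    have h1 := (hF (w n) (hwO n)).2 (1 / (n + 1) / (1 + ‖w n‖)) (div_pos (hκ n) h0).le h
    have h2 := mul_le_mul_of_nonneg_left h1 h0.le
    have h3 : (1 + ‖w n‖) * -(1 / (n + 1) / (1 + ‖w n‖) * ‖F (w n)‖) =
        -(1 / (n + 1) * ‖F (w n)‖) := by field_simp
    linarith [hw n]
  choose x hxO hxw hxφ hxm using hex
  have hxm' : ∀ n, minSubdiffNorm φ (x n) / 2 * (1 + ‖w n‖) < 1 / (n + 1) := fun n =>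
    (lt_div_iff₀ (by positivity)).1 (hxm n)
  have hm0 : ∀ n, 0 ≤ minSubdiffNorm φ (x n) := fun n => minSubdiffNorm_nonneg _
  have hm1 : ∀ n : ℕ, minSubdiffNorm φ (x n) / 2 ≤ 1 / (n + 1) := fun n => by
    nlinarith [hxm' n, hm0 n, norm_nonneg (w n), mul_nonneg (hm0 n) (norm_nonneg (w n))]
  obtain ⟨y, k, hk, hy⟩ := hC x ⟨max |a| |b'| + 1, fun n => by
      have h1 : |φ (w n)| ≤ max |a| |b'| := abs_le_max_abs_abs (hwO n).1.le (hwb n)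
      have h2 := abs_sub_abs_le_abs_sub (φ (x n)) (φ (w n))
      linarith [hxφ n, hm1 n, hκ1 n]⟩ (by
      refine squeeze_zero (fun n => mul_nonneg (by positivity) (hm0 n)) (fun n => ?_)
        -- One factor 2 undoes m/2, the other comes from 1 + ‖x_n‖ ≤ 2(1 + ‖w_n‖).
        (g := fun n : ℕ => 4 * ((1 : ℝ) / (n + 1))) (by simpa using hκlim.const_mul 4)
      have h1 : ‖x n‖ ≤ ‖w n‖ + 1 := by
        have := norm_sub_norm_le (x n) (w n)
        rw [← dist_eq_norm] at this
        linarith [hxw n, hm1 n, hκ1 n]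
      have h2 : (1 + ‖x n‖) * minSubdiffNorm φ (x n) ≤
          (2 * (1 + ‖w n‖)) * minSubdiffNorm φ (x n) :=
        mul_le_mul_of_nonneg_right (by linarith [norm_nonneg (w n)]) (hm0 n)
      linarith [hxm' n])
  have hklim := hκlim.comp hk.tendsto_atTop
  have hwy : Tendsto (w ∘ k) atTop (𝓝 y) := by
    refine hy.congr_dist (squeeze_zero (fun _ => dist_nonneg) (fun n => ?_) hklim)
    exact (hxw (k n)).le.trans (hm1 (k n))
  have hφy : Tendsto (fun n => φ (w (k n))) atTop (𝓝 (φ y)) :=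
    (hφ.continuous.tendsto y).comp hwy
  have hycrit : y ∈ critSet φ := by
    by_contra hy'
    obtain ⟨c, hc, hcm⟩ := exists_pos_eventually_le_minSubdiffNorm hφ hy'
    have h1 := hy.eventually hcm
    have h2 := hklim.eventually (gt_mem_nhds (half_pos hc))
    obtain ⟨n, h1, h2⟩ := (h1.and h2).exists
    simp only [Function.comp_apply] at h1 h2
    linarith [hm1 (k n)]
  have hya : φ y = a := by
    refine le_antisymm ?_ (ge_of_tendsto' hφy fun n => (hwO (k n)).1.le)
    by_contra! h
    exact hK y h (le_of_tendsto' hφy fun n => hwb (k n)) hycrit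
  obtain ⟨n, hn⟩ := (hwy.eventually (Metric.ball_mem_nhds y hδ)).exists
  exact absurd (hwδ (k n) y (mem_critSetAt_coe.2 ⟨hycrit, hya⟩)) (not_le.2 hn)

lemma exists_isDescentFlow [CompleteSpace X] (hφ : LocallyLipschitz φ) (hC : CeramiCondition φ)
    {a : ℝ} {b : EReal} (hK : ∀ u, a < φ u → (φ u : EReal) < b → u ∉ critSet φ) :
    ∃ F σ, IsDescentFlow φ a b F σ := by
  obtain ⟨F, h1, h2, h3, h4⟩ := exists_lipschitz_selection (isOpen_regularAbove hφ a)
    (descentCone hφ (regularAbove φ a))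
    (fun x hx => exists_eventually_mem_descentCone hφ hx hx.2)
  obtain ⟨σ, hσ⟩ := h1.exists_isFlowOf h2
  refine ⟨F, σ, hσ, h3, fun u hu => (h4 u hu).1, fun b' hb' δ hδ => ?_⟩
  exact hC.exists_rate hφ (fun u hu hub => hK u hu
    ((EReal.coe_le_coe_iff.2 hub).trans_lt hb')) h4 hδ

namespace IsDescentFlow

variable {a : ℝ} {b : EReal} {F : X → X} {σ : ℝ → X → X}

lemma apply_eq_self (h : IsDescentFlow φ a b F σ) {u : X} (hu : u ∉ regularAbove φ a) (t : ℝ) :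
    σ t u = u :=
  h.isFlow.fixed u (h.eq_zero u hu) t

/-- An orbit cannot enter the set of rest points: running time backwards would keep it there. -/
lemma mem_regularAbove (h : IsDescentFlow φ a b F σ) {u : X} (hu : u ∈ regularAbove φ a) (t : ℝ) :
    σ t u ∈ regularAbove φ a := by
  by_contra hcon
  have h1 := h.apply_eq_self hcon (-t)
  rw [← h.isFlow.add, neg_add_cancel, h.isFlow.zero] at h1
  exact hcon (h1 ▸ hu)

lemma genDirDeriv_nonpos (h : IsDescentFlow φ a b F σ) (u : X) :
    genDirDeriv φ u (F u) ≤ 0 := by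
  by_cases hu : u ∈ regularAbove φ a
  · exact (h.neg u hu).le
  · rw [h.eq_zero u hu, genDirDeriv_zero]

lemma antitoneOn (h : IsDescentFlow φ a b F σ) (hφ : LocallyLipschitz φ) (u : X) :
    AntitoneOn (fun t => φ (σ t u)) (Set.Ici 0) := by
  have := antitoneOn_add_mul_comp hφ (h.isFlow.hasDerivAt u) (ψ := fun _ => 0) continuous_const
    zero_le_one (fun t _ => ⟨0, le_rfl, by simp, by simpa using h.genDirDeriv_nonpos _⟩)
  simpa using this

lemma le_self (h : IsDescentFlow φ a b F σ) (hφ : LocallyLipschitz φ) (u : X) {t : ℝ}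
    (ht : 0 ≤ t) : φ (σ t u) ≤ φ u := by
  have := h.antitoneOn hφ u (Set.mem_Ici.2 le_rfl) ht ht
  simpa [h.isFlow.zero] using this

lemma lt_self (h : IsDescentFlow φ a b F σ) (hφ : LocallyLipschitz φ) {u : X}
    (hu : u ∈ regularAbove φ a) {t : ℝ} (ht : 0 < t) : φ (σ t u) < φ u := by
  have hneg := h.neg u hu
  have h1 := eventually_sub_le_of_hasDerivAt hφ (c := genDirDeriv φ u (F u) / 2)
    (h.isFlow.hasDerivAt u 0) (by rw [h.isFlow.zero]; linarith)
  rw [h.isFlow.zero] at h1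
  obtain ⟨s, hs, hs0, hst⟩ := (h1.and (Ioo_mem_nhdsGT ht)).exists
  have h2 := h.antitoneOn hφ u (Set.mem_Ici.2 hs0.le) (Set.mem_Ici.2 ht.le) hst.le
  simp only at h2
  nlinarith

/-- Lyapunov stability of z. A moving orbit stays above level a, so if it starts close to z it has
too little descent left to cross the annulus between radii e/2 and e. -/
lemma exists_forall_dist_le (h : IsDescentFlow φ a b F σ) (hφ : LocallyLipschitz φ)
    (hab : (a : EReal) < b) (hKa : (critSetAt φ (a : EReal)).Finite) {z : X} (hz : φ z ≤ a)
    {ε : ℝ} (hε : 0 < ε) :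
    ∃ δ > 0, ∀ u, dist u z < δ → ∀ t ≥ 0, dist (σ t u) z ≤ ε := by
  obtain ⟨b', hab', hb'⟩ := EReal.lt_iff_exists_real_btwn.1 hab
  rw [EReal.coe_lt_coe_iff] at hab'
  -- With e ≤ ρ, points of the annulus are at distance at least ρ from the other critical points of
  -- level a and at least e/2 from z, so the rate applies there.
  obtain ⟨ρ, hρ, hρZ⟩ : ∃ ρ > 0, ∀ z' ∈ critSetAt φ (a : EReal), z' ≠ z → 2 * ρ ≤ dist z' z := by
    have hcl : (critSetAt φ (a : EReal) \ {z})ᶜ ∈ 𝓝 z :=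
      (hKa.subset Set.sdiff_subset).isClosed.isOpen_compl.mem_nhds (by simp)
    obtain ⟨r, hr, hrb⟩ := Metric.mem_nhds_iff.1 hcl
    refine ⟨r / 2, half_pos hr, fun z' hz' hne => ?_⟩
    by_contra! hlt
    exact hrb (show z' ∈ Metric.ball z r by rw [Metric.mem_ball]; linarith) ⟨hz', hne⟩
  set e := min ε ρ with he
  have he0 : 0 < e := lt_min hε hρ
  obtain ⟨κ, hκ, hrate⟩ := h.rate b' hb' (e / 2) (half_pos he0)
  set C := (1 + ‖z‖ + e) / κ with hC
  have hC0 : 0 < C := by positivity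
  have hann : ∀ w ∈ regularAbove φ a, φ w ≤ b' → e / 2 ≤ dist w z → dist w z ≤ e →
      ‖F w‖ ≤ -(C * genDirDeriv φ w (F w)) := by
    intro w hw hwb h1 h2
    have h3 := hrate w hw hwb fun z' hz' => by
      by_cases hne : z' = z
      · rw [hne]; exact h1
      · have h4 := hρZ z' hz' hne
        have h5 := dist_triangle z' w z
        rw [dist_comm z' w] at h5
        linarith [min_le_right ε ρ]
    have hn : ‖w‖ ≤ ‖z‖ + e := by
      have := norm_sub_norm_le w z
      rw [← dist_eq_norm] at this
      linarith
    have h6 : κ * ‖F w‖ ≤ (1 + ‖z‖ + e) * -genDirDeriv φ w (F w) := by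
      refine h3.trans ?_
      rw [← mul_neg]
      exact mul_le_mul_of_nonneg_right (by linarith) (by linarith [h.neg w hw])
    rw [← mul_neg, hC, div_mul_eq_mul_div, le_div_iff₀ hκ]
    linarith
  -- The available drop allows a displacement of only e/4, less than the width e/2 of the annulus;
  -- the second term keeps the orbit below b'.
  set η := min (e / (4 * C)) (b' - a) with hη
  have hη0 : 0 < η := lt_min (by positivity) (sub_pos.2 hab')
  have hCη : C * η ≤ e / 4 := by
    calc C * η ≤ C * (e / (4 * C)) := mul_le_mul_of_nonneg_left (min_le_left _ _) hC0.le
      _ = e / 4 := by field_simp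
  obtain ⟨δ, hδ, hδφ⟩ := Metric.mem_nhds_iff.1
    ((hφ.continuous.tendsto z).eventually (gt_mem_nhds (lt_add_of_pos_right (φ z) hη0)))
  refine ⟨min δ (e / 2), lt_min hδ (half_pos he0), fun u hu t ht => ?_⟩
  have hue : dist u z < e / 2 := hu.trans_le (min_le_right _ _)
  have huφ : φ u < a + η := lt_of_lt_of_le (hδφ (hu.trans_le (min_le_left _ _))) (by linarith)
  have heε : e ≤ ε := min_le_left _ _
  by_cases huO : u ∈ regularAbove φ a
  swap
  · rw [h.apply_eq_self huO]
    linarith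
  have hanti := antitoneOn_add_mul_comp hφ (h.isFlow.hasDerivAt u)
    -- Truncating the distance makes ψ locally constant off the annulus, so the rate is needed only
    -- inside it.
    (ψ := fun w => max (e / 2) (min e (dist w z))) (by fun_prop) hC0.le (fun t ht => by
      set y := σ t u with hy
      have hyO : y ∈ regularAbove φ a := h.mem_regularAbove huO t
      have hyb : φ y ≤ b' := by
        have := h.le_self hφ u ht
        linarith [min_le_right (e / (4 * C)) (b' - a)]
      have hneg := h.neg y hyO
      have hcont : Tendsto (fun w => dist w z) (𝓝 y) (𝓝 (dist y z)) :=
        Continuous.tendsto (by fun_prop) y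
      rcases lt_or_ge (dist y z) (e / 2) with h1 | h1
      · refine ⟨0, le_rfl, ?_, by nlinarith⟩
        filter_upwards [hcont.eventually (gt_mem_nhds h1)] with w hw
        rw [max_eq_left ((min_le_right _ _).trans hw.le),
          max_eq_left ((min_le_right _ _).trans h1.le)]
        simp
      rcases lt_or_ge e (dist y z) with h2 | h2
      · refine ⟨0, le_rfl, ?_, by nlinarith⟩
        filter_upwards [hcont.eventually (lt_mem_nhds h2)] with w hw
        rw [min_eq_left hw.le, min_eq_left h2.le]
        simp
      · refine ⟨1, zero_le_one, Eventually.of_forall fun w => ?_, by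
          simpa using hann y hyO hyb h1 h2⟩
        have h3 := dist_triangle w y z
        rw [dist_eq_norm w y] at h3
        rw [min_eq_right h2, max_eq_right h1, one_mul, sub_le_iff_le_add]
        refine max_le ?_ ((min_le_right _ _).trans h3)
        linarith [norm_nonneg (w - y)])
  have h1 := hanti (Set.mem_Ici.2 le_rfl) (Set.mem_Ici.2 ht) ht
  simp only [h.isFlow.zero] at h1
  rw [max_eq_left ((min_le_right e (dist u z)).trans hue.le)] at h1
  have h2 : a < φ (σ t u) := (h.mem_regularAbove huO t).1
  have h3 : C * (φ u - φ (σ t u)) ≤ C * η := mul_le_mul_of_nonneg_left (by linarith) hC0.le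
  have h4 : min e (dist (σ t u) z) < e :=
    (le_max_right (e / 2) _).trans_lt (by linarith)
  rcases min_lt_iff.1 h4 with h5 | h5
  · exact absurd h5 (lt_irrefl _)
  · linarith

end IsDescentFlow

end DescentFlow

/-! ### Convergence of orbits. -/

section Deformation

variable {X : Type*} [NormedAddCommGroup X] [NormedSpace ℝ X] {φ : X → ℝ}

namespace IsDescentFlow

variable {a : ℝ} {b : EReal} {F : X → X} {σ : ℝ → X → X}

/-- The slope of log(1 + ‖·‖) is at most 1/(1 + ‖·‖), which cancels the Cerami weight; adding φ/κ
gives a decreasing quantity, and φ > a along the orbit. -/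
lemma exists_forall_norm_le (h : IsDescentFlow φ a b F σ) (hφ : LocallyLipschitz φ) {u : X}
    (hu : u ∈ regularAbove φ a) {κ : ℝ} (hκ : 0 < κ)
    (hrate : ∀ t ≥ 0, κ * ‖F (σ t u)‖ ≤
      -((1 + ‖σ t u‖) * genDirDeriv φ (σ t u) (F (σ t u)))) :
    ∃ M ≥ 0, ∀ t ≥ 0, ‖σ t u‖ ≤ M := by
  have hpos : ∀ w : X, 0 < 1 + ‖w‖ := fun w => by positivity
  have hanti := antitoneOn_add_mul_comp hφ (h.isFlow.hasDerivAt u)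
    (ψ := fun w => Real.log (1 + ‖w‖)) (C := 1 / κ)
    ((continuous_const.add continuous_norm).log fun w => (hpos w).ne') (by positivity)
    (fun t ht => by
      set y := σ t u with hy
      refine ⟨1 / (1 + ‖y‖), (div_pos one_pos (hpos y)).le, Eventually.of_forall fun w => ?_, ?_⟩
      · rw [← Real.log_div (hpos w).ne' (hpos y).ne']
        refine (Real.log_le_sub_one_of_pos (div_pos (hpos w) (hpos y))).trans ?_
        rw [div_sub_one (hpos y).ne', div_mul_eq_mul_div, one_mul,
          div_le_div_iff_of_pos_right (hpos y)]
        linarith [norm_sub_norm_le w y]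
      · rw [div_mul_eq_mul_div, one_mul, div_le_iff₀ (hpos y)]
        have := hrate t ht
        rw [mul_comm, ← le_div_iff₀ hκ] at this
        refine this.trans_eq ?_
        ring)
  refine ⟨Real.exp (Real.log (1 + ‖u‖) + 1 / κ * (φ u - a)), (Real.exp_pos _).le, fun t ht => ?_⟩
  have h1 := hanti (Set.mem_Ici.2 le_rfl) (Set.mem_Ici.2 ht) ht
  simp only [h.isFlow.zero] at h1
  have h2 : 1 / κ * a ≤ 1 / κ * φ (σ t u) :=
    mul_le_mul_of_nonneg_left (h.mem_regularAbove hu t).1.le (by positivity)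
  have h3 : Real.log (1 + ‖σ t u‖) ≤ Real.log (1 + ‖u‖) + 1 / κ * (φ u - a) := by
    rw [mul_sub]; linarith
  have := (Real.log_le_iff_le_exp (hpos _)).1 h3
  linarith

/-- If the speed is controlled by the rate of descent, the orbit converges to a point of level
at most `a`. -/
lemma exists_tendsto_of_norm_le [CompleteSpace X] (h : IsDescentFlow φ a b F σ)
    (hφ : LocallyLipschitz φ) (hK : ∀ u, a < φ u → (φ u : EReal) < b → u ∉ critSet φ) {u : X}
    (hu : u ∈ regularAbove φ a) (hub : (φ u : EReal) < b) {C : ℝ} (hC : 0 ≤ C)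
    (hrate : ∀ t ≥ 0, ‖F (σ t u)‖ ≤ -(C * genDirDeriv φ (σ t u) (F (σ t u)))) :
    ∃ y, φ y ≤ a ∧ Tendsto (fun n : ℕ => σ n u) atTop (𝓝 y) := by
  have hdist : ∀ s ≥ 0, ∀ t ≥ s, dist (σ t u) (σ s u) ≤ C * (φ (σ s u) - φ (σ t u)) := by
    intro s hs t hst
    have hanti := antitoneOn_add_mul_comp hφ (h.isFlow.hasDerivAt (σ s u))
      (ψ := fun w => dist w (σ s u)) (by fun_prop) hC (fun r hr => by
        rw [← h.isFlow.add]
        refine ⟨1, zero_le_one, Eventually.of_forall fun w => ?_, by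
          simpa using hrate (r + s) (by linarith)⟩
        rw [one_mul, sub_le_iff_le_add, ← dist_eq_norm]
        exact dist_triangle _ _ _)
    have h1 := hanti (Set.mem_Ici.2 le_rfl) (Set.mem_Ici.2 (sub_nonneg.2 hst)) (sub_nonneg.2 hst)
    simp only [h.isFlow.zero, dist_self, ← h.isFlow.add, sub_add_cancel] at h1
    linarith
  have hanti : Antitone fun n : ℕ => φ (σ n u) := fun m n hmn =>
    h.antitoneOn hφ u (Set.mem_Ici.2 m.cast_nonneg) (Set.mem_Ici.2 n.cast_nonneg)
      (Nat.cast_le.2 hmn)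
  have hbdd : BddBelow (Set.range fun n : ℕ => φ (σ n u)) :=
    ⟨a, by rintro _ ⟨n, rfl⟩; exact (h.mem_regularAbove hu n).1.le⟩
  have hlim := tendsto_atTop_ciInf hanti hbdd
  set ℓ := ⨅ n : ℕ, φ (σ n u) with hℓ
  have hcauchy : CauchySeq fun n : ℕ => σ n u := by
    refine cauchySeq_of_le_tendsto_0' (fun n : ℕ => C * (φ (σ n u) - ℓ)) (fun m n hmn => ?_) ?_
    · rw [dist_comm]
      refine (hdist m m.cast_nonneg n (Nat.cast_le.2 hmn)).trans ?_
      exact mul_le_mul_of_nonneg_left (by linarith [ciInf_le hbdd n]) hC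
    · simpa using (hlim.sub_const ℓ).const_mul C
  obtain ⟨y, hy⟩ := cauchySeq_tendsto_of_complete hcauchy
  refine ⟨y, ?_, hy⟩
  by_contra! hya
  have hyu : φ y ≤ φ u := by
    refine le_of_tendsto' ((hφ.continuous.tendsto y).comp hy) fun n => ?_
    exact h.le_self hφ u n.cast_nonneg
  have hyO : y ∈ regularAbove φ a :=
    ⟨hya, hK y hya ((EReal.coe_le_coe_iff.2 hyu).trans_lt hub)⟩
  -- The limit y is fixed by the time-one map, whereas a regular point above a would descend
  -- strictly.
  have h1 : Tendsto (fun n : ℕ => σ 1 (σ n u)) atTop (𝓝 (σ 1 y)) := by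
    have : Continuous (σ 1) := h.isFlow.continuous.comp (Continuous.prodMk_right 1)
    exact (this.tendsto y).comp hy
  have h2 : Tendsto (fun n : ℕ => σ 1 (σ n u)) atTop (𝓝 y) := by
    refine ((tendsto_add_atTop_iff_nat 1).2 hy).congr fun n => ?_
    rw [← h.isFlow.add]
    push_cast
    rw [add_comm]
  have h3 := h.lt_self hφ hyO one_pos
  rw [tendsto_nhds_unique h1 h2] at h3
  exact lt_irrefl _ h3

lemma exists_approached [CompleteSpace X] (h : IsDescentFlow φ a b F σ)
    (hφ : LocallyLipschitz φ) (hK : ∀ u, a < φ u → (φ u : EReal) < b → u ∉ critSet φ)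
    (hKa : (critSetAt φ (a : EReal)).Finite) {u : X}
    (hu : u ∈ regularAbove φ a) (hub : (φ u : EReal) < b) :
    ∃ y, φ y ≤ a ∧ ∀ ε > 0, ∃ t ≥ 0, dist (σ t u) y < ε := by
  by_cases hZ : ∃ z ∈ critSetAt φ (a : EReal), ∀ ε > 0, ∃ t ≥ 0, dist (σ t u) z < ε
  · obtain ⟨z, hz, hzε⟩ := hZ
    exact ⟨z, (mem_critSetAt_coe.1 hz).2.le, hzε⟩
  push Not at hZ
  choose! e he0 he using hZ
  -- Finiteness of K_a makes the distance from the orbit uniform.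
  obtain ⟨δ, hδ, hδe⟩ : ∃ δ > 0, ∀ z ∈ critSetAt φ (a : EReal), δ ≤ e z := by
    have : ∀ᶠ δ in 𝓝[>] (0 : ℝ), ∀ z ∈ critSetAt φ (a : EReal), δ ≤ e z :=
      (eventually_all_finite hKa).2 fun z hz =>
        mem_of_superset (Ioo_mem_nhdsGT (he0 z hz)) fun x hx => hx.2.le
    obtain ⟨δ, h1, h2⟩ := (this.and self_mem_nhdsWithin).exists
    exact ⟨δ, h2, h1⟩
  obtain ⟨κ, hκ, hrate⟩ := h.rate (φ u) hub δ hδ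
  have hrate' : ∀ t ≥ 0, κ * ‖F (σ t u)‖ ≤
      -((1 + ‖σ t u‖) * genDirDeriv φ (σ t u) (F (σ t u))) := fun t ht =>
    hrate _ (h.mem_regularAbove hu t) (h.le_self hφ u ht)
      fun z hz => (hδe z hz).trans (he z hz t ht)
  obtain ⟨M, hM, hMb⟩ := h.exists_forall_norm_le hφ hu hκ hrate'
  obtain ⟨y, hy, hlim⟩ := h.exists_tendsto_of_norm_le hφ hK hu hub (C := (1 + M) / κ)
    (by positivity) fun t ht => by
      rw [← mul_neg, div_mul_eq_mul_div, le_div_iff₀ hκ, mul_comm ‖_‖]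
      refine (hrate' t ht).trans ?_
      rw [← mul_neg]
      exact mul_le_mul_of_nonneg_right (by linarith [hMb t ht])
        (neg_nonneg.2 (h.genDirDeriv_nonpos _))
  refine ⟨y, hy, fun ε hε => ?_⟩
  obtain ⟨n, hn⟩ := (hlim.eventually (Metric.ball_mem_nhds y hε)).exists
  exact ⟨n, n.cast_nonneg, hn⟩

lemma exists_tendsto [CompleteSpace X] (h : IsDescentFlow φ a b F σ)
    (hφ : LocallyLipschitz φ) (hab : (a : EReal) < b)
    (hK : ∀ u, a < φ u → (φ u : EReal) < b → u ∉ critSet φ)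
    (hKa : (critSetAt φ (a : EReal)).Finite) {u : X} (hu : u ∈ sublevel φ b \ critSetAt φ b) :
    ∃ y, φ y ≤ a ∧ Tendsto (fun t => σ t u) atTop (𝓝 y) := by
  by_cases hua : φ u ≤ a
  · refine ⟨u, hua, tendsto_const_nhds.congr fun t => (h.apply_eq_self (fun hu => ?_) t).symm⟩
    exact absurd hu.1 (not_lt.2 hua)
  push Not at hua
  have huc : u ∉ critSet φ := fun hc => by
    rcases lt_or_eq_of_le (show (φ u : EReal) ≤ b from hu.1) with hlt | heq
    · exact hK u hua hlt hc
    · exact hu.2 ⟨hc, heq⟩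
  have huO : u ∈ regularAbove φ a := ⟨hua, huc⟩
  -- The rate is known only strictly below b; one unit of time brings a starting point of level b
  -- there.
  obtain ⟨y, hy, hyε⟩ := h.exists_approached hφ hK hKa (h.mem_regularAbove huO 1)
    ((EReal.coe_lt_coe_iff.2 (h.lt_self hφ huO one_pos)).trans_le hu.1)
  refine ⟨y, hy, Metric.nhds_basis_closedBall.tendsto_right_iff.2 fun ε hε => ?_⟩
  obtain ⟨δ, hδ, hstay⟩ := h.exists_forall_dist_le hφ hab hKa hy hε
  obtain ⟨t, ht, htδ⟩ := hyε δ hδ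
  filter_upwards [eventually_ge_atTop (t + 1)] with s hs
  have := hstay _ htδ (s - (t + 1)) (by linarith)
  rwa [← h.isFlow.add, ← h.isFlow.add, add_assoc, sub_add_cancel] at this

end IsDescentFlow

/-! ### The completed deformation. -/

/-- The time change `t ↦ t / (1 - t)` of a flow, completed by the limits `Φ` at `t = 1`. -/
noncomputable def completedFlow (σ : ℝ → X → X) (Φ : X → X) (t : ℝ) (u : X) : X :=
  if t < 1 then σ (t / (1 - t)) u else Φ u

/-- At t = 1, stability of Φ u does the work: at some time s the orbit of u, and hence those of
nearby points, is so close to Φ u that it stays close forever, and so do the limits. -/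
lemma IsDescentFlow.continuous_completedFlow {a : ℝ} {b : EReal} {F : X → X} {σ : ℝ → X → X}
    (h : IsDescentFlow φ a b F σ) (hφ : LocallyLipschitz φ) (hab : (a : EReal) < b)
    (hKa : (critSetAt φ (a : EReal)).Finite) {S : Set X} {Φ : X → X}
    (hΦa : ∀ u ∈ S, φ (Φ u) ≤ a) (hΦ : ∀ u ∈ S, Tendsto (fun t => σ t u) atTop (𝓝 (Φ u))) :
    Continuous fun p : unitInterval × S => completedFlow σ Φ p.1 p.2 := by
  rw [continuous_iff_continuousAt]
  rintro ⟨t, u⟩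
  rcases lt_or_ge (t : ℝ) 1 with ht | ht
  · have hev : ∀ᶠ p : unitInterval × S in 𝓝 (t, u), ((p.1 : ℝ)) < 1 :=
      (Continuous.tendsto (by fun_prop : Continuous fun p : unitInterval × S => (p.1 : ℝ))
        (t, u)).eventually (gt_mem_nhds ht)
    have hc : ContinuousAt (fun p : unitInterval × S => σ ((p.1 : ℝ) / (1 - p.1)) p.2) (t, u) := by
      refine (h.isFlow.continuous.continuousAt).comp
        (f := fun p : unitInterval × S => ((p.1 : ℝ) / (1 - p.1), (p.2 : X)))
        (ContinuousAt.prodMk (ContinuousAt.div (by fun_prop) (by fun_prop) ?_) (by fun_prop))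
      exact (sub_pos.2 ht).ne'
    refine hc.congr (hev.mono fun p hp => ?_)
    simp [completedFlow, hp]
  · rw [ContinuousAt]
    simp only [completedFlow, if_neg (not_lt.2 ht)]
    refine Metric.nhds_basis_closedBall.tendsto_right_iff.2 fun ε hε => ?_
    obtain ⟨δ, hδ, hstay⟩ := h.exists_forall_dist_le hφ hab hKa (hΦa u u.2) hε
    obtain ⟨s, hsδ, hs0⟩ := (((hΦ u u.2).eventually (Metric.ball_mem_nhds _ hδ)).and
      (eventually_ge_atTop 0)).exists
    have hσs : Continuous (σ s) := h.isFlow.continuous.comp (Continuous.prodMk_right s)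
    have hu : ∀ᶠ p : unitInterval × S in 𝓝 (t, u), dist (σ s p.2) (Φ u) < δ :=
      (Continuous.tendsto (by fun_prop : Continuous fun p : unitInterval × S => σ s p.2)
        (t, u)).eventually (Metric.isOpen_ball.mem_nhds hsδ)
    -- The time change sends s / (1 + s) to s.
    have ht' : ∀ᶠ p : unitInterval × S in 𝓝 (t, u), s / (1 + s) < (p.1 : ℝ) :=
      (Continuous.tendsto (by fun_prop : Continuous fun p : unitInterval × S => (p.1 : ℝ))
        (t, u)).eventually (lt_mem_nhds (lt_of_lt_of_le
          ((div_lt_one (by linarith)).2 (by linarith)) ht))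
    filter_upwards [hu, ht'] with p hp hpt
    have hlate : ∀ r ≥ s, dist (σ r p.2) (Φ u) ≤ ε := fun r hr => by
      have := hstay _ hp (r - s) (sub_nonneg.2 hr)
      rwa [← h.isFlow.add, sub_add_cancel] at this
    rw [Metric.mem_closedBall]
    split_ifs with hp1
    · refine hlate _ ?_
      rw [div_lt_iff₀ (by linarith)] at hpt
      rw [ge_iff_le, le_div_iff₀ (by linarith)]
      linarith
    · exact le_of_tendsto ((hΦ p.2 p.2.2).dist tendsto_const_nhds)
        ((eventually_ge_atTop s).mono hlate)

lemma IsDescentFlow.completedFlow_mem {a : ℝ} {b : EReal} {F : X → X} {σ : ℝ → X → X}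
    (h : IsDescentFlow φ a b F σ) (hφ : LocallyLipschitz φ) (hab : (a : EReal) < b) {Φ : X → X}
    {u : X} (hu : u ∈ sublevel φ b \ critSetAt φ b) (hΦ : φ (Φ u) ≤ a) {t : ℝ} (ht : 0 ≤ t) :
    completedFlow σ Φ t u ∈ sublevel φ b \ critSetAt φ b := by
  rw [completedFlow]
  split_ifs with ht1
  · have hs : 0 ≤ t / (1 - t) := div_nonneg ht (by linarith)
    by_cases huO : u ∈ regularAbove φ a
    · exact ⟨(EReal.coe_le_coe_iff.2 (h.le_self hφ u hs)).trans hu.1,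
        fun hc => (h.mem_regularAbove huO _).2 hc.1⟩
    · rwa [h.apply_eq_self huO]
  · have hlt : (φ (Φ u) : EReal) < b := (EReal.coe_le_coe_iff.2 hΦ).trans_lt hab
    exact ⟨hlt.le, fun hc => hlt.ne hc.2⟩

end Deformation

theorem mainTheorem4 {X : Type*} [NormedAddCommGroup X] [NormedSpace ℝ X] [CompleteSpace X]
    (hX : IsReflexiveSpace X) (φ : X → ℝ) (hφ : LocallyLipschitz φ) (hC : CeramiCondition φ)
    (a : ℝ) (b : EReal) (hab : (a : EReal) < b)
    (hKa : (critSetAt φ (a : EReal)).Finite)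
    (hK : ∀ c : ℝ, a < c → (c : EReal) < b → critSetAt φ (c : EReal) = ∅) :
    (∃ h : C(unitInterval × ↥(sublevel φ b \ critSetAt φ b), ↥(sublevel φ b \ critSetAt φ b)),
      (∀ u : ↥(sublevel φ b \ critSetAt φ b),
        h (0, u) = u ∧ (h (1, u) : X) ∈ sublevel φ (a : EReal)) ∧
      (∀ (t : unitInterval) (u : ↥(sublevel φ b \ critSetAt φ b)),
        (u : X) ∈ sublevel φ (a : EReal) → h (t, u) = u) ∧
      (∀ (t : unitInterval) (u : ↥(sublevel φ b \ critSetAt φ b)), φ (h (t, u)) ≤ φ u)) ∧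
    IsStrongDeformationRetract (sublevel φ (a : EReal)) (sublevel φ b \ critSetAt φ b) := by
  have hK' : ∀ u, a < φ u → (φ u : EReal) < b → u ∉ critSet φ := fun u h1 h2 hc =>
    Set.eq_empty_iff_forall_notMem.1 (hK (φ u) h1 h2) u ⟨hc, rfl⟩
  obtain ⟨F, σ, h⟩ := exists_isDescentFlow hφ hC hK'
  choose! Φ hΦa hΦ using fun u (hu : u ∈ sublevel φ b \ critSetAt φ b) =>
    h.exists_tendsto hφ hab hK' hKa hu
  have hrest : ∀ u ∈ sublevel φ b \ critSetAt φ b, φ u ≤ a → ∀ t, completedFlow σ Φ t u = u := by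
    intro u hu hua t
    have hself : ∀ s, σ s u = u := h.apply_eq_self fun hu => absurd hu.1 (not_lt.2 hua)
    rw [completedFlow]
    split_ifs
    · exact hself _
    · exact tendsto_nhds_unique (hΦ u hu) (tendsto_const_nhds.congr fun t => (hself t).symm)
  let H : C(unitInterval × ↥(sublevel φ b \ critSetAt φ b), ↥(sublevel φ b \ critSetAt φ b)) :=
    ⟨fun p => ⟨completedFlow σ Φ p.1 p.2,
      h.completedFlow_mem hφ hab p.2.2 (hΦa _ p.2.2) p.1.2.1⟩,
      (h.continuous_completedFlow hφ hab hKa hΦa hΦ).subtype_mk _⟩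
  have hH : ∀ t u, (H (t, u) : X) = completedFlow σ Φ t u := fun _ _ => rfl
  have h0 : ∀ u, H (0, u) = u := fun u => Subtype.ext <| by
    rw [hH]
    simp [completedFlow, h.isFlow.zero]
  have h1 : ∀ u, (H (1, u) : X) ∈ sublevel φ (a : EReal) := fun u => by
    rw [hH]
    simpa [completedFlow, sublevel] using hΦa u u.2
  have h2 : ∀ (t : unitInterval) (u : ↥(sublevel φ b \ critSetAt φ b)),
      (u : X) ∈ sublevel φ (a : EReal) → H (t, u) = u := fun t u hu =>
    Subtype.ext <| (hH t u).trans <| hrest u u.2 (EReal.coe_le_coe_iff.1 hu) t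
  refine ⟨⟨H, fun u => ⟨h0 u, h1 u⟩, h2, fun t u => ?_⟩, fun u hu => ?_, H, h0, h1, h2⟩
  · rw [hH, completedFlow]
    split_ifs with ht
    · exact h.le_self hφ u (div_nonneg t.2.1 (by linarith))
    · refine le_of_tendsto ((hφ.continuous.tendsto _).comp (hΦ u u.2)) ?_
      exact (eventually_ge_atTop 0).mono fun s hs => h.le_self hφ u hs
  · have hlt : (φ u : EReal) < b := lt_of_le_of_lt hu hab
    exact ⟨hlt.le, fun hc => hlt.ne hc.2⟩
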